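/- **Conventions.** Vocabularies $\tau$ are finite and relational, structures may be empty, and formulas are first-order formulas in negation normal form, built from literals and the constants $\mathsf{True},\mathsf{False}$ with $\wedge,\vee,\exists,\forall$. The *rank* of a formula is the maximal number of quantifiers on a root-to-leaf path. The classes $\widetilde\Sigma_n,\widetilde\Pi_n$ are defined by induction on $n$: $\widetilde\Sigma_0=\widetilde\Pi_0$ is the class of quantifier-free formulas; for $n>0$, $\widetilde\Sigma_n$ consists of the formulas $\exists y_1\cdots\exists y_r\bigwedge_{i\in I}\gamma_i$ with $r\ge 0$, $I$ finite, and each $\gamma_i\in\widetilde\Pi_k$ for some $k<n$, and $\widetilde\Pi_n$ consists of the formulas $\forall y_1\cdots\forall y_r\bigvee_{i\in I}\gamma_i$ with each $\gamma_i\in\widetilde\Sigma_k$ for some $k<n$ (a conjunction or disjunction with one member is that member). $\widetilde\Sigma_n[m]$, $\widetilde\Pi_n[m]$ are the subclasses of formulas of rank at most $m$. The *annotated disjoint union* $A_1\,\underline{\cup}\,A_2$ of two $\tau$-structures is their disjoint union expanded by a new unary predicate $P$ that holds exactly on $A_1$. For a class $\mathcal L$ of formulas, a (finite) *$\mathcal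 L$ reduction sequence* $D(\bar x_1,\bar x_2)=(\Delta_1,\Delta_2,\beta)$ over $\tau$ consists of two families $\Delta_j=(\psi_{i,j})_{i\in I}$ ($j=1,2$) with a common finite index set $I$, where $\psi_{i,j}$ is an $\mathcal L$ formula over $\tau$ with free variables among $\bar x_j$, and of a propositional formula $\beta$ built with $\wedge$, $\vee$ (and $\mathsf{True},\mathsf{False}$) from variables $X_{i,j}$. It is a *Feferman–Vaught decomposition* of $\varphi(\bar x_1,\bar x_2)$ over the annotated disjoint union if for all $\tau$-structures $A_1,A_2$ and all tuples $\bar a_1,\bar a_2$ from them, $(A_1\,\underline{\cup}\,A_2,\bar a_1,\bar a_2)\models\varphi$ if and only if the assignment that makes $X_{i,j}$ true exactly when $(A_j,\bar a_j)\models\psi_{i,j}$ satisfies $\beta$. Formulas and reduction sequences are represented by binary trees (their parse trees, with variables and relation symbols numbered and the numbers written in binary, and with arbitrary binary trees as the indices $i$); $|\varphi|$ and $|D|$ denote the numbers of nodes, and $|\varphi(\bar x_1,\bar x_2)|$ the number of nodes of the representation of the triple $(\varphi,\bar x_1,\bar x_2)$. Time is the number of steps of a program in the first-order functional language over binary trees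 (empty tree, pairing, projections, test for emptiness, local definitions, recursive function calls) with unit cost per operation. Finally $\mathrm{tower}(0,k)=k$ and $\mathrm{tower}(n+1,k)=2^{\mathrm{tower}(n,k)}$. **Theorem.** There are a constant $c$ and a program such that the following holds for every vocabulary $\tau$ (with any numbering of its symbols), all $n,m\in\mathbb N$ and each of the logics $\mathcal L=\widetilde\Sigma_n[m]$ and $\mathcal L=\widetilde\Pi_n[m]$. Let $\varphi$ be an $\mathcal L$ formula over $\tau\cup\{P\}$ whose free variables are among two disjoint finite tuples $\bar x_1,\bar x_2$ of variables. Then there is an $\mathcal L$ reduction sequence $D(\bar x_1,\bar x_2)$ over $\tau$ such that 1. $D(\bar x_1,\bar x_2)$ is a Feferman–Vaught decomposition of $\varphi(\bar x_1,\bar x_2)$ over the annotated disjoint union; 2. $|D|\le\mathrm{tower}(n,\,c\,(n+1)\,|\varphi|)$, and the program computes $D$ from $\varphi(\bar x_1,\bar x_2)$ in time at most $\mathrm{tower}(n,\,c\,(n+1)\,|\varphi(\bar x_1,\bar x_2)|^2)$. -/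

import Mathlib

universe uF uR u v

namespace FVD

/-! ### Data and programs: a first-order functional language over binary trees

The running time is measured in the usual unit-cost model of pure first-order functional programs
(no mutation) whose only data are binary trees. -/

/-- Binary trees built from `nil` by pairing. -/
inductive Dat : Type
  | nil : Dat
  | cons : Dat → Dat → Dat

namespace Dat

/-- The number of nodes of a tree. -/
def size : Dat → ℕ
  | nil => 1
  | cons a b => a.size + b.size + 1

/-- First component (`nil` for the empty tree). -/
def head : Dat → Dat
  | nil => nil
  | cons a _ => a

/-- Second component (`nil` for the empty tree). -/
def tail : Dat → Dat
  | nil => nil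
  | cons _ b => b

/-- A small number in unary; used only for the finitely many constructor tags below. -/
def tag : ℕ → Dat
  | 0 => nil
  | k + 1 => cons nil (tag k)

/-- A truth value. -/
def ofBool : Bool → Dat
  | false => nil
  | true => cons nil nil

/-- A finite sequence of trees. -/
def ofList : List Dat → Dat
  | [] => nil
  | d :: l => cons d (ofList l)

/-- A natural number, written in binary (least significant digit first). -/
def ofNat (k : ℕ) : Dat := ofList (k.bits.map ofBool)

end Dat

/-- Expressions. `var i` is the `i`-th innermost local variable; `letE e b` evaluates `e` and binds
the value in `b`; `call f e` calls the `f`-th function of the program on the value of `e`. -/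
inductive Exp : Type
  | var (i : ℕ)
  | nil
  | cons (a b : Exp)
  | head (e : Exp)
  | tail (e : Exp)
  | ite (c a b : Exp)
  | letE (e b : Exp)
  | call (f : ℕ) (e : Exp)

/-- A program: the list of the bodies of its (mutually recursive, one-argument) functions.
The function number `0` is the main function. -/
abbrev Program : Type := List Exp

/-- `Eval P env e d t`: with local variables `env`, the expression `e` evaluates to `d` in exactly
`t` steps. Every evaluation of an expression node is one step. A conditional evaluates only the
branch that is taken (the first one if the value of the test is not `nil`). -/
inductive Eval (P : Program) : List Dat → Exp → Dat → ℕ → Prop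
  | var {env : List Dat} {i : ℕ} {d : Dat} (h : env[i]? = some d) : Eval P env (.var i) d 1
  | nil {env : List Dat} : Eval P env .nil .nil 1
  | cons {env : List Dat} {a b : Exp} {d d' : Dat} {s t : ℕ} (ha : Eval P env a d s)
      (hb : Eval P env b d' t) : Eval P env (.cons a b) (.cons d d') (s + t + 1)
  | head {env : List Dat} {e : Exp} {d : Dat} {t : ℕ} (h : Eval P env e d t) :
      Eval P env (.head e) d.head (t + 1)
  | tail {env : List Dat} {e : Exp} {d : Dat} {t : ℕ} (h : Eval P env e d t) :
      Eval P env (.tail e) d.tail (t + 1)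
  | ite_true {env : List Dat} {c a b : Exp} {d₁ d₂ d : Dat} {s t : ℕ}
      (hc : Eval P env c (.cons d₁ d₂) s) (ha : Eval P env a d t) :
      Eval P env (.ite c a b) d (s + t + 1)
  | ite_false {env : List Dat} {c a b : Exp} {d : Dat} {s t : ℕ}
      (hc : Eval P env c .nil s) (hb : Eval P env b d t) :
      Eval P env (.ite c a b) d (s + t + 1)
  | letE {env : List Dat} {e b : Exp} {d d' : Dat} {s t : ℕ} (he : Eval P env e d s)
      (hb : Eval P (d :: env) b d' t) : Eval P env (.letE e b) d' (s + t + 1)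
  | call {env : List Dat} {f : ℕ} {e body : Exp} {d d' : Dat} {s t : ℕ}
      (hf : P[f]? = some body) (he : Eval P env e d s) (hb : Eval P [d] body d' t) :
      Eval P env (.call f e) d' (s + t + 1)

/-- The program `P`, started on `input`, halts with result `output` after exactly `t` steps. -/
def Program.Computes (P : Program) (input output : Dat) (t : ℕ) : Prop :=
  ∃ main, P[0]? = some main ∧ Eval P [input] main output t

/-! ### First-order formulas in negation normal form -/

/-- First-order formulas in negation normal form over a (relational) vocabulary `L`; the variables
are `x₀, x₁, x₂, …`. In a literal the Boolean `pos` is `true` for the atom and `false` for its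
negation. -/
inductive Fml (L : FirstOrder.Language.{uF, uR}) : Type uR
  | tru : Fml L
  | fls : Fml L
  | rel (pos : Bool) {k : ℕ} (R : L.Relations k) (x : Fin k → ℕ) : Fml L
  | eq (pos : Bool) (x y : ℕ) : Fml L
  | and (φ ψ : Fml L) : Fml L
  | or (φ ψ : Fml L) : Fml L
  | ex (z : ℕ) (φ : Fml L) : Fml L
  | all (z : ℕ) (φ : Fml L) : Fml L

namespace Fml

variable {L : FirstOrder.Language.{uF, uR}}

/-- The variables with a free occurrence. -/
def freeVars : Fml L → Set ℕ
  | tru => ∅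
  | fls => ∅
  | rel _ _ x => Set.range x
  | eq _ x y => {x, y}
  | and φ ψ => φ.freeVars ∪ ψ.freeVars
  | or φ ψ => φ.freeVars ∪ ψ.freeVars
  | ex z φ => φ.freeVars \ {z}
  | all z φ => φ.freeVars \ {z}

/-- Quantifier rank: the maximal number of quantifiers on a root-to-leaf path. -/
def rank : Fml L → ℕ
  | tru => 0
  | fls => 0
  | rel _ _ _ => 0
  | eq _ _ _ => 0
  | and φ ψ => max φ.rank ψ.rank
  | or φ ψ => max φ.rank ψ.rank
  | ex _ φ => φ.rank + 1
  | all _ φ => φ.rank + 1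

/-- Quantifier-free formulas. -/
def IsQF : Fml L → Prop
  | tru => True
  | fls => True
  | rel _ _ _ => True
  | eq _ _ _ => True
  | and φ ψ => φ.IsQF ∧ ψ.IsQF
  | or φ ψ => φ.IsQF ∧ ψ.IsQF
  | ex _ _ => False
  | all _ _ => False

/-- Satisfaction in an `L`-structure `A`, under an assignment `val` of elements to variables.
Assignments are partial, so that structures may be empty; a variable without a value makes a
literal false, but this never happens when `val` is defined on the free variables. -/
def Sat {A : Type u} [L.Structure A] : (ℕ → Option A) → Fml L → Prop
  | _, tru => True
  | _, fls => False
  | val, rel (k := k) pos R x => ∃ a : Fin k → A, (∀ i, val (x i) = some (a i)) ∧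
      (FirstOrder.Language.Structure.RelMap R a ↔ pos = true)
  | val, eq pos x y => ∃ a b : A, val x = some a ∧ val y = some b ∧ (a = b ↔ pos = true)
  | val, and φ ψ => Sat val φ ∧ Sat val ψ
  | val, or φ ψ => Sat val φ ∨ Sat val ψ
  | val, ex z φ => ∃ a : A, Sat (Function.update val z (some a)) φ
  | val, all z φ => ∀ a : A, Sat (Function.update val z (some a)) φ

/-- The tree that represents a formula, given trees for the relation symbols: a constructor tag
followed by the components. -/
def enc (sym : ∀ k, L.Relations k → Dat) : Fml L → Dat
  | tru => .cons (.tag 0) .nil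
  | fls => .cons (.tag 1) .nil
  | rel (k := k) pos R x => .cons (.tag 2) (.cons (.ofBool pos) (.cons (sym k R)
      (.ofList (List.ofFn fun i => Dat.ofNat (x i)))))
  | eq pos x y => .cons (.tag 3) (.cons (.ofBool pos) (.cons (.ofNat x) (.ofNat y)))
  | and φ ψ => .cons (.tag 4) (.cons (φ.enc sym) (ψ.enc sym))
  | or φ ψ => .cons (.tag 5) (.cons (φ.enc sym) (ψ.enc sym))
  | ex z φ => .cons (.tag 6) (.cons (.ofNat z) (φ.enc sym))
  | all z φ => .cons (.tag 7) (.cons (.ofNat z) (φ.enc sym))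

end Fml

/-! ### The logics `Σ̃ₙ[m]` and `Π̃ₙ[m]` -/

/-- The two kinds of logics. -/
inductive Kind : Type
  | sigma
  | pi

namespace Kind

variable {L : FirstOrder.Language.{uF, uR}}

/-- The other kind. -/
def dual : Kind → Kind
  | sigma => pi
  | pi => sigma

/-- The empty conjunction, respectively the empty disjunction. -/
def unit : Kind → Fml L
  | sigma => .tru
  | pi => .fls

/-- Conjunction, respectively disjunction. -/
def conn : Kind → Fml L → Fml L → Fml L
  | sigma => .and
  | pi => .or

/-- Existential, respectively universal quantification. -/
def quant : Kind → ℕ → Fml L → Fml L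
  | sigma => .ex
  | pi => .all

end Kind

/-- `InClass K n r φ`: the formula `φ` belongs to `Σ̃_{n,r}` (`K = sigma`) or `Π̃_{n,r}` (`K = pi`).
For `n = 0` these are the quantifier-free formulas. For `n > 0`, `Σ̃_{n,0}` consists of the finite
conjunctions (written with the constant `True` and the binary connective; a conjunction with one
member is that member) of formulas from the classes `Π̃_k` with `k < n`, and `Σ̃_{n,r+1}` adds to
`Σ̃_{n,r}` the formulas `∃ z φ` with `φ` in `Σ̃_{n,r}`. Dually for `Π̃`. -/
inductive InClass {L : FirstOrder.Language.{uF, uR}} : Kind → ℕ → ℕ → Fml L → Prop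
  | qf {K : Kind} {φ : Fml L} (h : φ.IsQF) : InClass K 0 0 φ
  | empty {K : Kind} {n : ℕ} : InClass K (n + 1) 0 K.unit
  | member {K : Kind} {n k r : ℕ} {γ : Fml L} (hk : k < n + 1) (h : InClass K.dual k r γ) :
      InClass K (n + 1) 0 γ
  | join {K : Kind} {n : ℕ} {φ ψ : Fml L} (h₁ : InClass K (n + 1) 0 φ)
      (h₂ : InClass K (n + 1) 0 ψ) : InClass K (n + 1) 0 (K.conn φ ψ)
  | weaken {K : Kind} {n r : ℕ} {φ : Fml L} (h : InClass K (n + 1) r φ) :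
      InClass K (n + 1) (r + 1) φ
  | quant {K : Kind} {n r : ℕ} {φ : Fml L} (z : ℕ) (h : InClass K (n + 1) r φ) :
      InClass K (n + 1) (r + 1) (K.quant z φ)

/-- The logic `Σ̃ₙ[m]` (`K = sigma`) or `Π̃ₙ[m]` (`K = pi`): formulas of the class of quantifier rank
at most `m`. -/
def InLogic {L : FirstOrder.Language.{uF, uR}} (K : Kind) (n m : ℕ) (φ : Fml L) : Prop :=
  (∃ r, InClass K n r φ) ∧ φ.rank ≤ m

/-! ### The annotated disjoint union -/

/-- The relation symbols of the annotation: a single unary predicate. -/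
inductive AnnotRel : ℕ → Type
  | P : AnnotRel 1

/-- The vocabulary `{P}`. -/
def annotLang : FirstOrder.Language.{0, 0} := ⟨fun _ => Empty, AnnotRel⟩

/-- The vocabulary `τ ∪ {P}` with a new unary predicate `P`. -/
abbrev withP (τ : FirstOrder.Language.{uF, uR}) : FirstOrder.Language := τ.sum annotLang

/-- The disjoint union of two relational structures: every relation symbol is interpreted by the
union of its interpretations in the two structures. -/
abbrev disjointUnion (τ : FirstOrder.Language.{uF, uR}) [hτ : τ.IsRelational] (A₁ : Type u) (A₂ : Type v)
    [τ.Structure A₁] [τ.Structure A₂] : τ.Structure (A₁ ⊕ A₂) where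
  funMap {k} f _ := (hτ k).elim f
  RelMap R a := (∃ b, (∀ i, a i = Sum.inl (b i)) ∧ FirstOrder.Language.Structure.RelMap R b) ∨
    (∃ b, (∀ i, a i = Sum.inr (b i)) ∧ FirstOrder.Language.Structure.RelMap R b)

/-- The predicate `P` holds exactly on the elements of the first structure. -/
abbrev annotation (A₁ : Type u) (A₂ : Type v) : annotLang.Structure (A₁ ⊕ A₂) where
  funMap f _ := Empty.elim f
  RelMap
    | .P, a => ∃ b : A₁, a 0 = Sum.inl b

/-- The annotated disjoint union of two `τ`-structures. -/
abbrev annotatedUnion (τ : FirstOrder.Language.{uF, uR}) [τ.IsRelational] (A₁ : Type u) (A₂ : Type v)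
    [τ.Structure A₁] [τ.Structure A₂] : (withP τ).Structure (A₁ ⊕ A₂) :=
  letI := disjointUnion τ A₁ A₂
  letI := annotation A₁ A₂
  FirstOrder.Language.sumStructure τ annotLang (A₁ ⊕ A₂)

/-! ### Reduction sequences -/

/-- Finite negation-free propositional formulas over the variables `X_{i,1}` and `X_{i,2}`. The
indices `i` are arbitrary trees. -/
inductive PForm : Type
  | tru : PForm
  | fls : PForm
  | var₁ (i : Dat) : PForm
  | var₂ (i : Dat) : PForm
  | and (α β : PForm) : PForm
  | or (α β : PForm) : PForm

namespace PForm

/-- Truth under the assignment `X_{i,1} ↦ ζ₁ i`, `X_{i,2} ↦ ζ₂ i`. -/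
def Holds (ζ₁ ζ₂ : Dat → Bool) : PForm → Prop
  | tru => True
  | fls => False
  | var₁ i => ζ₁ i = true
  | var₂ i => ζ₂ i = true
  | and α β => α.Holds ζ₁ ζ₂ ∧ β.Holds ζ₁ ζ₂
  | or α β => α.Holds ζ₁ ζ₂ ∨ β.Holds ζ₁ ζ₂

/-- The indices of the propositional variables that occur. -/
def indices : PForm → Set Dat
  | tru => ∅
  | fls => ∅
  | var₁ i => {i}
  | var₂ i => {i}
  | and α β => α.indices ∪ β.indices
  | or α β => α.indices ∪ β.indices

/-- The tree that represents a propositional formula. -/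
def enc : PForm → Dat
  | tru => .cons (.tag 0) .nil
  | fls => .cons (.tag 1) .nil
  | var₁ i => .cons (.tag 2) i
  | var₂ i => .cons (.tag 3) i
  | and α β => .cons (.tag 4) (.cons α.enc β.enc)
  | or α β => .cons (.tag 5) (.cons α.enc β.enc)

end PForm

/-- The raw data of a (finite) reduction sequence: the entries `(i, ψ_{i,1}, ψ_{i,2})`, which make
up the two families `Δ₁` and `Δ₂` with their common index set, and the propositional formula `β`. -/
structure RedSeq (τ : FirstOrder.Language.{uF, uR}) where
  entries : List (Dat × Fml τ × Fml τ)
  β : PForm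

namespace RedSeq

variable {τ : FirstOrder.Language.{uF, uR}}

/-- `D` is an `𝓛` reduction sequence `D(x̄₁, x̄₂)`: the entries form families indexed by the indices
(an index determines its entry), `ψ_{i,j}` is a formula of the logic `𝓛` with its free variables
among `x̄_j`, and `β` is a formula over the propositional variables of these indices. -/
structure IsReductionSequence (𝓛 : Fml τ → Prop) (xs₁ xs₂ : List ℕ) (D : RedSeq τ) : Prop where
  family : ∀ e ∈ D.entries, ∀ e' ∈ D.entries, e.1 = e'.1 → e = e'
  logic₁ : ∀ e ∈ D.entries, 𝓛 e.2.1
  logic₂ : ∀ e ∈ D.entries, 𝓛 e.2.2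
  free₁ : ∀ e ∈ D.entries, ∀ x ∈ e.2.1.freeVars, x ∈ xs₁
  free₂ : ∀ e ∈ D.entries, ∀ x ∈ e.2.2.freeVars, x ∈ xs₂
  vars : ∀ i ∈ D.β.indices, ∃ e ∈ D.entries, e.1 = i

/-- The assignment that gives the variables of `xs` the values `a`. -/
def assign {A : Type u} (xs : List ℕ) (a : {x // x ∈ xs} → A) (x : ℕ) : Option A :=
  if h : x ∈ xs then some (a ⟨x, h⟩) else none

/-- The assignment that gives the variables of `xs₁` the values `a₁` in the first summand, and those
of `xs₂` the values `a₂` in the second summand. -/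
def assignSum {A₁ : Type u} {A₂ : Type v} (xs₁ xs₂ : List ℕ) (a₁ : {x // x ∈ xs₁} → A₁)
    (a₂ : {x // x ∈ xs₂} → A₂) (x : ℕ) : Option (A₁ ⊕ A₂) :=
  if h : x ∈ xs₁ then some (Sum.inl (a₁ ⟨x, h⟩))
  else if h : x ∈ xs₂ then some (Sum.inr (a₂ ⟨x, h⟩)) else none

/-- `(A₁, A₂, ā₁, ā₂)` is a model of `D(x̄₁, x̄₂)`. -/
def Models (D : RedSeq τ) (xs₁ xs₂ : List ℕ) {A₁ : Type u} {A₂ : Type v} [τ.Structure A₁]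
    [τ.Structure A₂] (a₁ : {x // x ∈ xs₁} → A₁) (a₂ : {x // x ∈ xs₂} → A₂) : Prop :=
  ∃ ζ₁ ζ₂ : Dat → Bool, D.β.Holds ζ₁ ζ₂ ∧ ∀ e ∈ D.entries,
    (ζ₁ e.1 = true ↔ e.2.1.Sat (assign xs₁ a₁)) ∧ (ζ₂ e.1 = true ↔ e.2.2.Sat (assign xs₂ a₂))

/-- `D(x̄₁, x̄₂)` is a Feferman–Vaught decomposition of `φ(x̄₁, x̄₂)` over the annotated disjoint
union: for all structures and all tuples of their elements. -/
def IsFVDecomposition [τ.IsRelational] (D : RedSeq τ) (φ : Fml (withP τ)) (xs₁ xs₂ : List ℕ) :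
    Prop :=
  ∀ (A₁ : Type u) (A₂ : Type v) [τ.Structure A₁] [τ.Structure A₂]
    (a₁ : {x // x ∈ xs₁} → A₁) (a₂ : {x // x ∈ xs₂} → A₂),
    letI := annotatedUnion τ A₁ A₂
    φ.Sat (assignSum xs₁ xs₂ a₁ a₂) ↔ D.Models xs₁ xs₂ a₁ a₂

end RedSeq

/-! ### Representation of inputs and outputs; sizes -/

section Coding

variable {τ : FirstOrder.Language.{uF, uR}} (code : (Σ k, τ.Relations k) → ℕ)

/-- The tree that represents a symbol of `τ`, given a numbering of the symbols of `τ`. -/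
def symDat (k : ℕ) (R : τ.Relations k) : Dat := .cons .nil (.ofNat (code ⟨k, R⟩))

/-- The tree that represents a symbol of `τ ∪ {P}`; `P` is represented by `nil`. -/
def symDatP (k : ℕ) : (withP τ).Relations k → Dat
  | .inl R => symDat code k R
  | .inr _ => .nil

/-- The tree that represents a tuple of variables. -/
def encVars (xs : List ℕ) : Dat := .ofList (xs.map Dat.ofNat)

/-- The tree that represents a formula over `τ ∪ {P}`. -/
def encFml (φ : Fml (withP τ)) : Dat := φ.enc (symDatP code)

/-- The tree that represents the input `φ(x̄₁, x̄₂)`. -/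
def encInput (φ : Fml (withP τ)) (xs₁ xs₂ : List ℕ) : Dat :=
  .cons (encFml code φ) (.cons (encVars xs₁) (encVars xs₂))

/-- The tree that represents a reduction sequence over `τ`. -/
def encRedSeq (D : RedSeq τ) : Dat :=
  .cons (.ofList (D.entries.map fun e =>
    .cons e.1 (.cons (e.2.1.enc (symDat code)) (e.2.2.enc (symDat code))))) D.β.enc

end Coding

/-- The `n`-fold exponential. -/
def tower : ℕ → ℕ → ℕ
  | 0, k => k
  | n + 1, k => 2 ^ tower n k

end FVD

open FVD

namespace FVD

/-! Once the side of every variable is known, the disjoint union can be unravelled syntactically. An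
atom holds iff all its variables lie on one side and it holds in that summand; `P` is decided by the
side alone; a quantifier over the union splits into one over each summand. Recursion on the formula,
carrying an assignment of sides (`Sides`), therefore yields a monotone combination (`Comb`) of
formulas, each evaluated in a single summand.

The only step that costs anything is a quantifier. For `∃ z` the combination of the body is brought
into disjunctive normal form, a list of pairs (ψ₁, ψ₂) standing for ⋁ (ψ₁ ∧ ψ₂). Then `∃ z`
distributes over the disjunction and, when z ranges over the first summand, acts on ψ₁ alone, since
ψ₂ speaks about the other side. `∀ z` is dual, with conjunctive normal forms.

A normal form costs an exponential, which must be paid once per block of equal quantifiers and not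
once per quantifier. For this reason `reduce` also returns a normal form for each kind: the list of
a `K`-quantification for its own kind `K` comes from the list of its body by quantifying entries,
and `normalForm` is applied anew only where the kind changes or a block meets a connective. The
height of the tower is thus the number of nested alternating blocks (`depth`), at most n on both
classes (`InClass.depth_le`).

The logics are preserved because the pairs of kind `K` are built with `K.conn`, the connective under
which the quantifier-free-prefix part of a class of kind `K` is closed (`comb_all_inClass`,
`comb_all_rank`). Correctness is `comb_sat` and the size bound is `size_comb_le`. The program
follows `reduce` step by step and the number of its calls obeys the same recurrences (`combTime`),
except that literals scan the list of sides; this makes the bottom of the tower quadratic. Finally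
each leaf, side and formula together, serves as its own index, so that the code of the combination
already is the code of β. -/

/-! ### Monotone combinations of formulas over two structures -/

/-- Monotone propositional combinations of formulas, each of which is to be evaluated in the first
structure (`leaf true ψ`) or in the second one (`leaf false ψ`). -/
inductive Comb (τ : FirstOrder.Language.{uF, uR}) : Type uR
  | tru : Comb τ
  | fls : Comb τ
  | leaf (s : Bool) (ψ : Fml τ) : Comb τ
  | and (α β : Comb τ) : Comb τ
  | or (α β : Comb τ) : Comb τ

/-- The sides of variables: `(true, x)` assigns `x` to the first structure; earlier entries take
precedence, and variables without an entry belong to the second structure. -/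
abbrev Sides : Type := List (Bool × ℕ)

/-- Whether the variable belongs to the first structure. -/
def Sides.side : Sides → ℕ → Bool
  | [], _ => false
  | (s, y) :: env, x => if y = x then s else Sides.side env x

namespace Comb

variable {τ : FirstOrder.Language.{uF, uR}}

/-- Truth in a pair of structures with assignments. -/
def Sat {A₁ : Type u} {A₂ : Type v} [τ.Structure A₁] [τ.Structure A₂] (v₁ : ℕ → Option A₁)
    (v₂ : ℕ → Option A₂) : Comb τ → Prop
  | tru => True
  | fls => False
  | leaf true ψ => ψ.Sat v₁
  | leaf false ψ => ψ.Sat v₂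
  | and α β => α.Sat v₁ v₂ ∧ β.Sat v₁ v₂
  | or α β => α.Sat v₁ v₂ ∨ β.Sat v₁ v₂

/-- All leaves have the property `C`. -/
def All (C : Bool → Fml τ → Prop) : Comb τ → Prop
  | tru => True
  | fls => True
  | leaf s ψ => C s ψ
  | and α β => α.All C ∧ β.All C
  | or α β => α.All C ∧ β.All C

theorem All.imp {C C' : Bool → Fml τ → Prop} (h : ∀ s ψ, C s ψ → C' s ψ) :
    ∀ {b : Comb τ}, b.All C → b.All C'
  | tru, _ => trivial
  | fls, _ => trivial
  | leaf s ψ, hb => h s ψ hb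
  | and _ _, hb => ⟨hb.1.imp h, hb.2.imp h⟩
  | or _ _, hb => ⟨hb.1.imp h, hb.2.imp h⟩

end Comb

/-! ### Normal forms and the recursive reduction. -/

section

variable {τ : FirstOrder.Language.{uF, uR}}

/-- Disjunction, respectively conjunction, of the combinations of two formulas: existential
quantifiers distribute over `fold sigma`, and universal ones over `fold pi`. -/
def foldPairs : Kind → List (Fml τ × Fml τ) → Comb τ
  | .sigma, [] => .fls
  | .sigma, p :: l => .or (.and (.leaf true p.1) (.leaf false p.2)) (foldPairs .sigma l)
  | .pi, [] => .tru
  | .pi, p :: l => .and (.or (.leaf true p.1) (.leaf false p.2)) (foldPairs .pi l)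

/-- The pairs of the componentwise conjunctions, respectively disjunctions. -/
def prodPairs (K : Kind) (l l' : List (Fml τ × Fml τ)) : List (Fml τ × Fml τ) :=
  l.flatMap fun p => l'.map fun q => (K.conn p.1 q.1, K.conn p.2 q.2)

/-- Disjunctive (`sigma`), respectively conjunctive (`pi`), normal form. -/
def normalForm : Kind → Comb τ → List (Fml τ × Fml τ)
  | .sigma, .tru => [(.tru, .tru)]
  | .sigma, .fls => []
  | .pi, .tru => []
  | .pi, .fls => [(.fls, .fls)]
  | K, .leaf true ψ => [(ψ, K.unit)]
  | K, .leaf false ψ => [(K.unit, ψ)]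
  | .sigma, .and α β => prodPairs .sigma (normalForm .sigma α) (normalForm .sigma β)
  | .sigma, .or α β => normalForm .sigma α ++ normalForm .sigma β
  | .pi, .and α β => normalForm .pi α ++ normalForm .pi β
  | .pi, .or α β => prodPairs .pi (normalForm .pi α) (normalForm .pi β)

/-- Quantification of the component on one side. -/
def quantPair (s : Bool) (K : Kind) (z : ℕ) (p : Fml τ × Fml τ) : Fml τ × Fml τ :=
  if s then (K.quant z p.1, p.2) else (p.1, K.quant z p.2)

/-- The reduction of a literal whose variables all belong to the first structure (`a₁`),
respectively to the second structure (`a₂`). -/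
def litComb (pos a₁ a₂ : Bool) (ψ : Fml τ) : Comb τ :=
  if pos then .or (if a₁ then .leaf true ψ else .fls) (if a₂ then .leaf false ψ else .fls)
  else .and (if a₁ then .leaf true ψ else .tru) (if a₂ then .leaf false ψ else .tru)

/-- Whether all variables belong to the side `s`. -/
def allSide (env : Sides) (s : Bool) (xs : List ℕ) : Bool :=
  xs.all fun x => env.side x == s

/-- The reduction of a relational literal. -/
def relComb (env : Sides) (pos : Bool) {k : ℕ} (R : (withP τ).Relations k) (x : Fin k → ℕ) :
    Comb τ :=
  match k, R, x with
  | _, .inl R, x => litComb pos (allSide env true (List.ofFn x)) (allSide env false (List.ofFn x))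
      (.rel pos R x)
  | _, .inr .P, x => if env.side (x 0) == pos then .tru else .fls

/-- The result for a formula that is no quantification: its reduction and the normal forms. -/
def plainResult (b : Comb τ) : Comb τ × (Kind → List (Fml τ × Fml τ)) :=
  (b, fun K => normalForm K b)

/-- The result for a quantified formula. -/
def quantResult (K : Kind) (z : ℕ) (f : Sides → Comb τ × (Kind → List (Fml τ × Fml τ)))
    (env : Sides) : Comb τ × (Kind → List (Fml τ × Fml τ)) :=
  let l := ((f ((true, z) :: env)).2 K).map (quantPair true K z) ++
    ((f ((false, z) :: env)).2 K).map (quantPair false K z)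
  (foldPairs K l, fun K' => match K, K' with
    | .sigma, .sigma => l
    | .pi, .pi => l
    | _, K' => normalForm K' (foldPairs K l))

/-- The reduction of a formula, together with its normal forms for both kinds. The normal form of a
quantification of the same kind is found by distributing the quantifier over a normal form. -/
def reduce : Fml (withP τ) → Sides → Comb τ × (Kind → List (Fml τ × Fml τ))
  | .tru, _ => plainResult .tru
  | .fls, _ => plainResult .fls
  | .rel pos R x, env => plainResult (relComb env pos R x)
  | .eq pos x y, env => plainResult (litComb pos (allSide env true [x, y])
      (allSide env false [x, y]) (.eq pos x y))
  | .and φ ψ, env => plainResult (.and (reduce φ env).1 (reduce ψ env).1)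
  | .or φ ψ, env => plainResult (.or (reduce φ env).1 (reduce ψ env).1)
  | .ex z φ, env => quantResult .sigma z (reduce φ) env
  | .all z φ, env => quantResult .pi z (reduce φ) env

/-- The Boolean combination of formulas that a formula over the disjoint union reduces to. -/
def comb (φ : Fml (withP τ)) (env : Sides) : Comb τ := (reduce φ env).1

/-- A normal form of `comb φ env`, with the outermost quantifiers of the given kind pulled in. -/
def pairs (K : Kind) (φ : Fml (withP τ)) (env : Sides) : List (Fml τ × Fml τ) := (reduce φ env).2 K

theorem comb_quant (K : Kind) (z : ℕ) (φ : Fml (withP τ)) (env : Sides) :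
    comb (K.quant z φ) env = foldPairs K (pairs K (K.quant z φ) env) := by
  cases K <;> rfl

theorem pairs_quant (K : Kind) (z : ℕ) (φ : Fml (withP τ)) (env : Sides) :
    pairs K (K.quant z φ) env = (pairs K φ ((true, z) :: env)).map (quantPair true K z) ++
      (pairs K φ ((false, z) :: env)).map (quantPair false K z) := by
  cases K <;> rfl

/-- The formula is a quantification of the kind `K`. -/
def IsQuant (K : Kind) : Fml (withP τ) → Prop
  | .ex _ _ => K = .sigma
  | .all _ _ => K = .pi
  | _ => False

/-- Together with `pairs_quant` this determines `pairs` completely: either the quantifier is pulled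
in, or the normal form is computed afresh. -/
theorem pairs_of_not_isQuant {K : Kind} {φ : Fml (withP τ)} (h : ¬ IsQuant K φ) (env : Sides) :
    pairs K φ env = normalForm K (comb φ env) := by
  cases φ <;> cases K <;> first | rfl | exact absurd rfl h

theorem not_isQuant_of_isQF {K : Kind} {φ : Fml (withP τ)} (h : φ.IsQF) : ¬ IsQuant K φ := by
  cases φ <;> simp_all [IsQuant, Fml.IsQF]

theorem IsQuant.exists {K : Kind} {φ : Fml (withP τ)} (h : IsQuant K φ) :
    ∃ z ψ, φ = K.quant z ψ := by
  cases φ <;> simp only [IsQuant] at h <;> subst h <;> exact ⟨_, _, rfl⟩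

theorem not_isQuant_conn (K K' : Kind) (φ ψ : Fml (withP τ)) : ¬ IsQuant K' (K.conn φ ψ) := by
  cases K <;> exact id

theorem not_isQuant_unit (K K' : Kind) : ¬ IsQuant K' (K.unit : Fml (withP τ)) := by
  cases K <;> exact id

theorem not_isQuant_dual_quant (K : Kind) (z : ℕ) (φ : Fml (withP τ)) :
    ¬ IsQuant K.dual (K.quant z φ) := by
  cases K <;> exact fun h => nomatch h

-- Merges the two quantifier cases into one, so that dual arguments are carried out once for a
-- variable kind.
@[elab_as_elim]
theorem Fml.quant_induction {L : FirstOrder.Language.{uF, uR}} {motive : Fml L → Prop}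
    (tru : motive .tru) (fls : motive .fls)
    (rel : ∀ (pos : Bool) {k : ℕ} (R : L.Relations k) (x : Fin k → ℕ), motive (.rel pos R x))
    (eq : ∀ (pos : Bool) (x y : ℕ), motive (.eq pos x y))
    (and : ∀ φ ψ, motive φ → motive ψ → motive (.and φ ψ))
    (or : ∀ φ ψ, motive φ → motive ψ → motive (.or φ ψ))
    (quant : ∀ (K : Kind) (z : ℕ) φ, motive φ → motive (K.quant z φ)) (φ : Fml L) : motive φ := by
  induction φ with
  | tru => exact tru
  | fls => exact fls
  | rel pos R x => exact rel pos R x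
  | eq pos x y => exact eq pos x y
  | and φ ψ h h' => exact and φ ψ h h'
  | or φ ψ h h' => exact or φ ψ h h'
  | ex z φ h => exact quant .sigma z φ h
  | all z φ h => exact quant .pi z φ h

/-! ### Properties of the leaves -/

theorem foldPairs_all {C : Bool → Fml τ → Prop} {K : Kind} {l : List (Fml τ × Fml τ)}
    (h : ∀ p ∈ l, C true p.1 ∧ C false p.2) : (foldPairs K l).All C := by
  induction l with
  | nil => cases K <;> trivial
  | cons p l ih =>
    have hp := h p (by simp)
    have hl := ih fun q hq => h q (by simp [hq])
    cases K <;> exact ⟨hp, hl⟩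

theorem prodPairs_forall {C : Bool → Fml τ → Prop} {K : Kind}
    (hc : ∀ s φ ψ, C s φ → C s ψ → C s (K.conn φ ψ)) {l l' : List (Fml τ × Fml τ)}
    (h : ∀ p ∈ l, C true p.1 ∧ C false p.2) (h' : ∀ p ∈ l', C true p.1 ∧ C false p.2) :
    ∀ p ∈ prodPairs K l l', C true p.1 ∧ C false p.2 := by
  intro p hp
  simp only [prodPairs, List.mem_flatMap, List.mem_map] at hp
  obtain ⟨q, hq, q', hq', rfl⟩ := hp
  exact ⟨hc _ _ _ (h q hq).1 (h' q' hq').1, hc _ _ _ (h q hq).2 (h' q' hq').2⟩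

/-- Each component of a normal form is built by `K.conn` from units and from leaves of its own side,
so every property closed under these passes from the leaves to the pairs. It is applied to rank,
free variables and class membership. -/
theorem normalForm_forall {C : Bool → Fml τ → Prop} {K : Kind} (hu : ∀ s, C s K.unit)
    (hc : ∀ s φ ψ, C s φ → C s ψ → C s (K.conn φ ψ)) {b : Comb τ} (hb : b.All C) :
    ∀ p ∈ normalForm K b, C true p.1 ∧ C false p.2 := by
  have append {l l' : List (Fml τ × Fml τ)} (h : ∀ p ∈ l, C true p.1 ∧ C false p.2)
      (h' : ∀ p ∈ l', C true p.1 ∧ C false p.2) : ∀ p ∈ l ++ l', C true p.1 ∧ C false p.2 := by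
    intro p hp
    rcases List.mem_append.1 hp with hp | hp
    exacts [h p hp, h' p hp]
  induction b with
  | tru => cases K <;> simp [normalForm]; exact ⟨hu true, hu false⟩
  | fls => cases K <;> simp [normalForm]; exact ⟨hu true, hu false⟩
  | leaf s ψ =>
    cases s <;> cases K <;> simp only [normalForm, List.mem_singleton, forall_eq] <;>
      first | exact ⟨hu _, hb⟩ | exact ⟨hb, hu _⟩
  | and α β ih ih' =>
    cases K
    · exact prodPairs_forall hc (ih hb.1) (ih' hb.2)
    · exact append (ih hb.1) (ih' hb.2)
  | or α β ih ih' =>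
    cases K
    · exact append (ih hb.1) (ih' hb.2)
    · exact prodPairs_forall hc (ih hb.1) (ih' hb.2)

theorem litComb_all {C : Bool → Fml τ → Prop} {pos a₁ a₂ : Bool} {ψ : Fml τ}
    (h₁ : a₁ = true → C true ψ) (h₂ : a₂ = true → C false ψ) : (litComb pos a₁ a₂ ψ).All C := by
  cases pos <;> cases a₁ <;> cases a₂ <;> simp_all [litComb, Comb.All]

theorem pairs_quant_forall {C : Bool → Fml τ → Prop} {K : Kind} {z : ℕ} {φ : Fml (withP τ)}
    {env : Sides}
    (h : ∀ s, ∀ p ∈ pairs K φ ((s, z) :: env), C true (quantPair s K z p).1 ∧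
      C false (quantPair s K z p).2) :
    ∀ p ∈ pairs K (K.quant z φ) env, C true p.1 ∧ C false p.2 := by
  intro p hp
  rw [pairs_quant, List.mem_append, List.mem_map, List.mem_map] at hp
  rcases hp with ⟨q, hq, rfl⟩ | ⟨q, hq, rfl⟩
  exacts [h _ q hq, h _ q hq]

theorem rank_quant {L : FirstOrder.Language.{uF, uR}} (K : Kind) (z : ℕ) (φ : Fml L) :
    (K.quant z φ).rank = φ.rank + 1 := by
  cases K <;> rfl

theorem rank_unit {L : FirstOrder.Language.{uF, uR}} (K : Kind) : (K.unit : Fml L).rank = 0 := by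
  cases K <;> rfl

theorem rank_conn {L : FirstOrder.Language.{uF, uR}} (K : Kind) (φ ψ : Fml L) :
    (K.conn φ ψ).rank = max φ.rank ψ.rank := by
  cases K <;> rfl

theorem freeVars_quant {L : FirstOrder.Language.{uF, uR}} (K : Kind) (z : ℕ) (φ : Fml L) :
    (K.quant z φ).freeVars = φ.freeVars \ {z} := by
  cases K <;> rfl

theorem freeVars_unit {L : FirstOrder.Language.{uF, uR}} (K : Kind) :
    (K.unit : Fml L).freeVars = ∅ := by
  cases K <;> rfl

theorem freeVars_conn {L : FirstOrder.Language.{uF, uR}} (K : Kind) (φ ψ : Fml L) :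
    (K.conn φ ψ).freeVars = φ.freeVars ∪ ψ.freeVars := by
  cases K <;> rfl

/-- The combination and the pairs are treated together because each is computed from the other: the
combination of a quantification from its pairs, the pairs for the other kind from the combination.
-/
theorem comb_all_rank (φ : Fml (withP τ)) : ∀ env,
    (comb φ env).All (fun _ ψ => ψ.rank ≤ φ.rank) ∧
    ∀ K, ∀ p ∈ pairs K φ env, p.1.rank ≤ φ.rank ∧ p.2.rank ≤ φ.rank := by
  have plain {φ : Fml (withP τ)} (K : Kind) (hφ : ¬ IsQuant K φ) {env : Sides}
      (h : (comb φ env).All (fun _ ψ => ψ.rank ≤ φ.rank)) :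
      ∀ p ∈ pairs K φ env, p.1.rank ≤ φ.rank ∧ p.2.rank ≤ φ.rank := by
    rw [pairs_of_not_isQuant hφ]
    exact normalForm_forall (C := fun _ ψ => ψ.rank ≤ φ.rank) (fun _ => by simp [rank_unit])
      (fun _ _ _ => by simp +contextual [rank_conn]) h
  induction φ using Fml.quant_induction with
  | tru => exact fun env => ⟨trivial, fun K => plain K id trivial⟩
  | fls => exact fun env => ⟨trivial, fun K => plain K id trivial⟩
  | rel pos R x =>
    intro env
    have : (comb (.rel pos R x) env).All
        (fun _ ψ => ψ.rank ≤ (Fml.rel pos R x : Fml (withP τ)).rank) := by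
      rcases R with R | (R : AnnotRel _)
      · exact litComb_all (fun _ => le_rfl) (fun _ => le_rfl)
      · cases R
        simp only [comb, reduce, plainResult, relComb]; split <;> trivial
    exact ⟨this, fun K => plain K id this⟩
  | eq pos x y =>
    intro env
    have : (comb (τ := τ) (.eq pos x y) env).All
        (fun _ ψ => ψ.rank ≤ (Fml.eq pos x y : Fml (withP τ)).rank) :=
      litComb_all (fun _ => le_rfl) (fun _ => le_rfl)
    exact ⟨this, fun K => plain K id this⟩
  | and φ ψ ih ih' =>
    intro env
    have : (comb (.and φ ψ) env).All (fun _ χ => χ.rank ≤ (Fml.and φ ψ).rank) :=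
      ⟨(ih env).1.imp fun _ _ => le_max_of_le_left, (ih' env).1.imp fun _ _ => le_max_of_le_right⟩
    exact ⟨this, fun K => plain K id this⟩
  | or φ ψ ih ih' =>
    intro env
    have : (comb (.or φ ψ) env).All (fun _ χ => χ.rank ≤ (Fml.or φ ψ).rank) :=
      ⟨(ih env).1.imp fun _ _ => le_max_of_le_left, (ih' env).1.imp fun _ _ => le_max_of_le_right⟩
    exact ⟨this, fun K => plain K id this⟩
  | quant K z φ ih =>
    intro env
    have hp : ∀ p ∈ pairs K (K.quant z φ) env,
        p.1.rank ≤ (K.quant z φ).rank ∧ p.2.rank ≤ (K.quant z φ).rank := by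
      refine pairs_quant_forall (C := fun _ ψ => ψ.rank ≤ (K.quant z φ).rank) fun s p hp => ?_
      have := (ih _).2 K p hp
      cases s <;> simp [quantPair, rank_quant] <;> omega
    have hb : (comb (K.quant z φ) env).All (fun _ ψ => ψ.rank ≤ (K.quant z φ).rank) := by
      rw [comb_quant]; exact foldPairs_all hp
    refine ⟨hb, fun K' => ?_⟩
    by_cases h : K' = K
    · subst h; exact hp
    · exact plain K' (by cases K <;> cases K' <;> simp_all [IsQuant, Kind.quant]) hb

theorem allSide_eq_true {env : Sides} {s : Bool} {xs : List ℕ} :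
    allSide env s xs = true ↔ ∀ x ∈ xs, env.side x = s := by
  simp [allSide]

/-- In the quantifier case z is bound in one component, and it cannot be free in the other because
there all free variables lie on the opposite side. The induction therefore has to carry the sides
along with the variables. -/
theorem comb_all_freeVars (φ : Fml (withP τ)) : ∀ env : Sides,
    (comb φ env).All (fun s ψ => ∀ x ∈ ψ.freeVars, x ∈ φ.freeVars ∧ env.side x = s) ∧
    ∀ K, ∀ p ∈ pairs K φ env, (∀ x ∈ p.1.freeVars, x ∈ φ.freeVars ∧ env.side x = true) ∧
      (∀ x ∈ p.2.freeVars, x ∈ φ.freeVars ∧ env.side x = false) := by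
  have plain {φ : Fml (withP τ)} (K : Kind) (hφ : ¬ IsQuant K φ) {env : Sides}
      (h : (comb φ env).All (fun s ψ => ∀ x ∈ ψ.freeVars, x ∈ φ.freeVars ∧ env.side x = s)) :
      ∀ p ∈ pairs K φ env, (∀ x ∈ p.1.freeVars, x ∈ φ.freeVars ∧ env.side x = true) ∧
      (∀ x ∈ p.2.freeVars, x ∈ φ.freeVars ∧ env.side x = false) := by
    rw [pairs_of_not_isQuant hφ]
    refine normalForm_forall
      (C := fun s ψ => ∀ x ∈ ψ.freeVars, x ∈ φ.freeVars ∧ env.side x = s)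
      (fun _ => by simp [freeVars_unit]) (fun s φ ψ h h' x hx => ?_) h
    rw [freeVars_conn] at hx
    exact hx.elim (h x) (h' x)
  induction φ using Fml.quant_induction with
  | tru => exact fun env => ⟨trivial, fun K => plain K id trivial⟩
  | fls => exact fun env => ⟨trivial, fun K => plain K id trivial⟩
  | rel pos R x =>
    intro env
    have : (comb (.rel pos R x) env).All (fun s ψ => ∀ y ∈ ψ.freeVars,
        y ∈ (Fml.rel pos R x : Fml (withP τ)).freeVars ∧ env.side y = s) := by
      rcases R with R | (R : AnnotRel _)
      · refine litComb_all (fun h y hy => ⟨hy, ?_⟩) (fun h y hy => ⟨hy, ?_⟩) <;>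
        · obtain ⟨i, rfl⟩ := hy
          exact allSide_eq_true.1 h _ (by simp)
      · cases R
        simp only [comb, reduce, plainResult, relComb]; split <;> trivial
    exact ⟨this, fun K => plain K id this⟩
  | eq pos x y =>
    intro env
    have : (comb (τ := τ) (.eq pos x y) env).All (fun s ψ => ∀ w ∈ ψ.freeVars,
        w ∈ (Fml.eq pos x y : Fml (withP τ)).freeVars ∧ env.side w = s) := by
      refine litComb_all (fun h w hw => ⟨hw, ?_⟩) (fun h w hw => ⟨hw, ?_⟩) <;>
        exact allSide_eq_true.1 h _ (by simpa [Fml.freeVars] using hw)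
    exact ⟨this, fun K => plain K id this⟩
  | and φ ψ ih ih' =>
    intro env
    have : (comb (.and φ ψ) env).All
        (fun s χ => ∀ x ∈ χ.freeVars, x ∈ (Fml.and φ ψ).freeVars ∧ env.side x = s) :=
      ⟨(ih env).1.imp fun _ _ h x hx => ⟨.inl (h x hx).1, (h x hx).2⟩,
        (ih' env).1.imp fun _ _ h x hx => ⟨.inr (h x hx).1, (h x hx).2⟩⟩
    exact ⟨this, fun K => plain K id this⟩
  | or φ ψ ih ih' =>
    intro env
    have : (comb (.or φ ψ) env).All
        (fun s χ => ∀ x ∈ χ.freeVars, x ∈ (Fml.or φ ψ).freeVars ∧ env.side x = s) :=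
      ⟨(ih env).1.imp fun _ _ h x hx => ⟨.inl (h x hx).1, (h x hx).2⟩,
        (ih' env).1.imp fun _ _ h x hx => ⟨.inr (h x hx).1, (h x hx).2⟩⟩
    exact ⟨this, fun K => plain K id this⟩
  | quant K z φ ih =>
    intro env
    have hp : ∀ p ∈ pairs K (K.quant z φ) env,
        (∀ x ∈ p.1.freeVars, x ∈ (K.quant z φ).freeVars ∧ env.side x = true) ∧
        (∀ x ∈ p.2.freeVars, x ∈ (K.quant z φ).freeVars ∧ env.side x = false) := by
      refine pairs_quant_forall (C := fun s ψ => ∀ x ∈ ψ.freeVars,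
        x ∈ (K.quant z φ).freeVars ∧ env.side x = s) fun s p hp => ?_
      obtain ⟨h₁, h₂⟩ := (ih _).2 K p hp
      simp only [Sides.side] at h₁ h₂
      simp only [freeVars_quant]
      constructor
      · intro x hx
        by_cases hz : z = x
        · subst hz
          cases s <;> simp [quantPair, freeVars_quant] at hx
          simpa using h₁ _ hx
        · cases s <;> simp [quantPair, freeVars_quant] at hx
          · simpa [hz, Ne.symm hz] using h₁ _ hx
          · simpa [hz, Ne.symm hz] using h₁ _ hx.1
      · intro x hx
        by_cases hz : z = x
        · subst hz
          cases s <;> simp [quantPair, freeVars_quant] at hx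
          simpa using h₂ _ hx
        · cases s <;> simp [quantPair, freeVars_quant] at hx
          · simpa [hz, Ne.symm hz] using h₂ _ hx.1
          · simpa [hz, Ne.symm hz] using h₂ _ hx
    have hb : (comb (K.quant z φ) env).All
        (fun s ψ => ∀ x ∈ ψ.freeVars, x ∈ (K.quant z φ).freeVars ∧ env.side x = s) := by
      rw [comb_quant]; exact foldPairs_all hp
    refine ⟨hb, fun K' => ?_⟩
    by_cases h : K' = K
    · subst h; exact hp
    · exact plain K' (by cases K <;> cases K' <;> simp_all [IsQuant, Kind.quant]) hb

end

section

variable {τ : FirstOrder.Language.{uF, uR}}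

/-! ### The logics of the leaves -/

theorem Kind.dual_dual (K : Kind) : K.dual.dual = K := by cases K <;> rfl

theorem inClass_unit {L : FirstOrder.Language.{uF, uR}} (K : Kind) (n : ℕ) :
    InClass K n 0 (K.unit : Fml L) := by
  cases n with
  | zero => exact .qf (by cases K <;> trivial)
  | succ n => exact .empty

theorem InClass.isQF {L : FirstOrder.Language.{uF, uR}} {K : Kind} {r : ℕ} {φ : Fml L}
    (h : InClass K 0 r φ) : φ.IsQF := by
  cases h; assumption

theorem inClass_conn {L : FirstOrder.Language.{uF, uR}} {K : Kind} {n : ℕ} {φ ψ : Fml L}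
    (h : InClass K n 0 φ) (h' : InClass K n 0 ψ) : InClass K n 0 (K.conn φ ψ) := by
  cases n with
  | zero => exact .qf (by cases K <;> exact ⟨h.isQF, h'.isQF⟩)
  | succ n => exact .join h h'

theorem comb_all_isQF {φ : Fml (withP τ)} (h : φ.IsQF) (env : Sides) :
    (comb φ env).All (fun _ ψ => ψ.IsQF) := by
  induction φ with
  | tru => trivial
  | fls => trivial
  | rel pos R x =>
    rcases R with R | (R : AnnotRel _)
    · exact litComb_all (fun _ => trivial) (fun _ => trivial)
    · cases R
      simp only [comb, reduce, plainResult, relComb]; split <;> trivial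
  | eq pos x y => exact litComb_all (fun _ => trivial) (fun _ => trivial)
  | and φ ψ ih ih' => exact ⟨ih h.1, ih' h.2⟩
  | or φ ψ ih ih' => exact ⟨ih h.1, ih' h.2⟩
  | ex z φ => exact h.elim
  | all z φ => exact h.elim

/-- The third claim serves the constructor `member`, where a formula of the dual kind is read as a
formula of kind `K` without prefix: its pairs of kind `K` must then lie in the prefix-free part of
`K`. The level `n'` is left free so that the claim can be used at whatever level contains the
member. -/
theorem comb_all_inClass {K : Kind} {n r : ℕ} {φ : Fml (withP τ)} (h : InClass K n r φ) :
    (∀ env, (comb φ env).All (fun _ ψ => InClass K n r ψ)) ∧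
    (∀ env, ∀ p ∈ pairs K φ env, InClass K n r p.1 ∧ InClass K n r p.2) ∧
    ∀ n', n ≤ n' → ∀ env, ∀ p ∈ pairs K.dual φ env,
      InClass K.dual (n' + 1) 0 p.1 ∧ InClass K.dual (n' + 1) 0 p.2 := by
  have nf {K : Kind} {n : ℕ} {φ : Fml (withP τ)} (hφ : ¬ IsQuant K φ) {env : Sides}
      (h : (comb φ env).All (fun _ ψ => InClass K n 0 ψ)) :
      ∀ p ∈ pairs K φ env, InClass K n 0 p.1 ∧ InClass K n 0 p.2 := by
    rw [pairs_of_not_isQuant hφ]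
    exact normalForm_forall (C := fun _ ψ => InClass K n 0 ψ) (fun _ => inClass_unit K n)
      (fun _ _ _ => inClass_conn) h
  have up {K : Kind} {n n' r : ℕ} (hn : n ≤ n') {b : Comb τ}
      (h : b.All (fun _ ψ => InClass K n r ψ)) :
      b.All (fun _ ψ => InClass K.dual (n' + 1) 0 ψ) :=
    h.imp fun _ _ h => .member (Nat.lt_succ_of_le hn) (by rwa [Kind.dual_dual])
  induction h with
  | @qf K φ h =>
    have hb : ∀ env, (comb φ env).All (fun _ ψ => InClass K 0 0 ψ) :=
      fun env => (comb_all_isQF h env).imp fun _ _ => .qf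
    exact ⟨hb, fun env => nf (not_isQuant_of_isQF h) (hb env),
      fun n' hn env => nf (not_isQuant_of_isQF h) (up hn (hb env))⟩
  | @empty K n =>
    have hb : ∀ env, (comb (K.unit : Fml (withP τ)) env).All
      (fun _ ψ => InClass K (n + 1) 0 ψ) := fun env => by cases K <;> trivial
    exact ⟨hb, fun env => nf (not_isQuant_unit _ _) (hb env),
      fun n' hn env => nf (not_isQuant_unit _ _) (up hn (hb env))⟩
  | @member K n k r γ hk h ih =>
    obtain ⟨ih₁, ih₂, ih₃⟩ := ih
    rw [Kind.dual_dual] at ih₃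
    refine ⟨fun env => (ih₁ env).imp fun _ _ h => .member hk h,
      ih₃ n (Nat.le_of_lt_succ hk), fun n' hn env p hp => ?_⟩
    obtain ⟨h₁, h₂⟩ := ih₂ env p hp
    -- Raising the level within one kind goes through the other kind: a formula of `K.dual` at level
    -- `k` is a member of `K` at level `n + 1`, which is a member of `K.dual` at level `n' + 1`.
    have lift {ψ : Fml τ} (h : InClass K.dual k r ψ) : InClass K.dual (n' + 1) 0 ψ :=
      .member (k := n + 1) (by omega) (by rw [Kind.dual_dual]; exact .member hk h)
    exact ⟨lift h₁, lift h₂⟩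
  | @join K n φ ψ h h' ih ih' =>
    have hb : ∀ env, (comb (K.conn φ ψ) env).All (fun _ ψ => InClass K (n + 1) 0 ψ) := fun env => by
      cases K <;> exact ⟨ih.1 env, ih'.1 env⟩
    exact ⟨hb, fun env => nf (not_isQuant_conn _ _ _ _) (hb env),
      fun n' hn env => nf (not_isQuant_conn _ _ _ _) (up hn (hb env))⟩
  | weaken h ih =>
    exact ⟨fun env => (ih.1 env).imp fun _ _ => .weaken,
      fun env p hp => ⟨.weaken (ih.2.1 env p hp).1, .weaken (ih.2.1 env p hp).2⟩, ih.2.2⟩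
  | @quant K n r φ z h ih =>
    have hp : ∀ env, ∀ p ∈ pairs K (K.quant z φ) env,
        InClass K (n + 1) (r + 1) p.1 ∧ InClass K (n + 1) (r + 1) p.2 := fun env => by
      refine pairs_quant_forall (C := fun _ ψ => InClass K (n + 1) (r + 1) ψ) fun s p hp => ?_
      obtain ⟨h₁, h₂⟩ := ih.2.1 _ p hp
      -- Only one component receives the quantifier; `weaken` brings the other into the same class.
      cases s
      · exact ⟨.weaken h₁, .quant z h₂⟩
      · exact ⟨.quant z h₁, .weaken h₂⟩
    have hb : ∀ env, (comb (K.quant z φ) env).All (fun _ ψ => InClass K (n + 1) (r + 1) ψ) :=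
      fun env => by
        rw [comb_quant]
        exact foldPairs_all (C := fun _ ψ => InClass K (n + 1) (r + 1) ψ) (hp env)
    exact ⟨hb, hp, fun n' hn env => nf (not_isQuant_dual_quant K z φ) (up hn (hb env))⟩

/-- `True` fills the unused component of each entry of the reduction sequence, for both kinds. -/
theorem inClass_tru {L : FirstOrder.Language.{uF, uR}} (K : Kind) (n : ℕ) :
    InClass K n 0 (.tru : Fml L) := by
  cases n with
  | zero => exact .qf trivial
  | succ n => exact .member (Nat.succ_pos n) (.qf trivial)

/-! ### Depth: the number of alternating blocks of quantifiers -/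

/-- The maximal number of nested blocks of quantifiers of the same kind, together with the number
that remains when the outermost block of the given kind is removed. -/
def depths {L : FirstOrder.Language.{uF, uR}} : Fml L → ℕ × (Kind → ℕ)
  | .and φ ψ => (max (depths φ).1 (depths ψ).1, fun _ => max (depths φ).1 (depths ψ).1)
  | .or φ ψ => (max (depths φ).1 (depths ψ).1, fun _ => max (depths φ).1 (depths ψ).1)
  | .ex _ φ => ((depths φ).2 .sigma + 1, fun
    | .sigma => (depths φ).2 .sigma
    | .pi => (depths φ).2 .sigma + 1)
  | .all _ φ => ((depths φ).2 .pi + 1, fun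
    | .sigma => (depths φ).2 .pi + 1
    | .pi => (depths φ).2 .pi)
  | _ => (0, fun _ => 0)

/-- The maximal number of nested blocks of quantifiers of the same kind. -/
def depth {L : FirstOrder.Language.{uF, uR}} (φ : Fml L) : ℕ := (depths φ).1

/-- The depth after the removal of the outermost block of quantifiers of the kind `K`. -/
def coreDepth {L : FirstOrder.Language.{uF, uR}} (K : Kind) (φ : Fml L) : ℕ := (depths φ).2 K

theorem depth_quant {L : FirstOrder.Language.{uF, uR}} (K : Kind) (z : ℕ) (φ : Fml L) :
    depth (K.quant z φ) = coreDepth K φ + 1 := by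
  cases K <;> rfl

theorem coreDepth_quant {L : FirstOrder.Language.{uF, uR}} (K : Kind) (z : ℕ) (φ : Fml L) :
    coreDepth K (K.quant z φ) = coreDepth K φ := by
  cases K <;> rfl

theorem coreDepth_of_not_isQuant {K : Kind} {φ : Fml (withP τ)} (h : ¬ IsQuant K φ) :
    coreDepth K φ = depth φ := by
  cases φ <;> cases K <;> first | rfl | exact absurd rfl h

theorem coreDepth_le (K : Kind) (φ : Fml (withP τ)) : coreDepth K φ ≤ depth φ := by
  by_cases h : IsQuant K φ
  · obtain ⟨z, ψ, rfl⟩ := h.exists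
    simp [depth_quant, coreDepth_quant]
  · exact (coreDepth_of_not_isQuant h).le

/-- The induction needs all three bounds: `quant` adds one to the core depth, since the block it
extends is already counted, and `join` needs the sharper bound for an empty prefix. -/
theorem InClass.depth_le {K : Kind} {n r : ℕ} {φ : Fml (withP τ)} (h : InClass K n r φ) :
    depth φ ≤ n ∧ coreDepth K φ ≤ n - 1 ∧ (r = 0 → depth φ ≤ n - 1) := by
  have zero {φ : Fml (withP τ)} (h : φ.IsQF) : depth φ = 0 := by
    induction φ with
    | and φ ψ ih ih' => exact Nat.max_eq_zero_iff.2 ⟨ih h.1, ih' h.2⟩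
    | or φ ψ ih ih' => exact Nat.max_eq_zero_iff.2 ⟨ih h.1, ih' h.2⟩
    | ex => exact h.elim
    | all => exact h.elim
    | _ => rfl
  have core {K : Kind} {n r : ℕ} {φ : Fml (withP τ)} (h : depth φ ≤ n) :
      depth φ ≤ n + 1 ∧ coreDepth K φ ≤ n + 1 - 1 ∧ (r = 0 → depth φ ≤ n + 1 - 1) := by
    have := coreDepth_le K φ
    omega
  induction h with
  | @qf K φ h =>
    have := zero h
    have := coreDepth_le K φ
    omega
  | @empty K n => exact core (by cases K <;> exact Nat.zero_le _)
  | @member K n k r γ hk h ih => exact core (by omega)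
  | @join K n φ ψ h h' ih ih' =>
    have : depth (K.conn φ ψ) = max (depth φ) (depth ψ) := by cases K <;> rfl
    exact core (by omega)
  | weaken h ih => exact ⟨ih.1, ih.2.1, by simp⟩
  | @quant K n r φ z h ih =>
    rw [depth_quant, coreDepth_quant]
    exact ⟨by omega, ih.2.1, by simp⟩

/-! ### Correctness -/

section Semantics

/-- The assignment to the disjoint union that takes the value of a variable from its side. -/
def merge {A₁ : Type u} {A₂ : Type v} (env : Sides) (v₁ : ℕ → Option A₁) (v₂ : ℕ → Option A₂) (x : ℕ) : Option (A₁ ⊕ A₂) :=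
  if env.side x then (v₁ x).map .inl else (v₂ x).map .inr

theorem update_merge_inl {A₁ : Type u} {A₂ : Type v} {v₁ : ℕ → Option A₁} {v₂ : ℕ → Option A₂}
    (env : Sides) (z : ℕ) (a : A₁) :
    Function.update (merge env v₁ v₂) z (some (.inl a)) =
      merge ((true, z) :: env) (Function.update v₁ z (some a)) v₂ := by
  funext x
  by_cases h : x = z
  · subst h; simp [merge, Sides.side]
  · simp [merge, Sides.side, h, Ne.symm h]

theorem update_merge_inr {A₁ : Type u} {A₂ : Type v} {v₁ : ℕ → Option A₁} {v₂ : ℕ → Option A₂}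
    (env : Sides) (z : ℕ) (a : A₂) :
    Function.update (merge env v₁ v₂) z (some (.inr a)) =
      merge ((false, z) :: env) v₁ (Function.update v₂ z (some a)) := by
  funext x
  by_cases h : x = z
  · subst h; simp [merge, Sides.side]
  · simp [merge, Sides.side, h, Ne.symm h]

variable {A₁ : Type u} {A₂ : Type v} [τ.Structure A₁] [τ.Structure A₂]

/-- The truth of a normal form. -/
def PairsSat (v₁ : ℕ → Option A₁) (v₂ : ℕ → Option A₂) : Kind → List (Fml τ × Fml τ) → Prop
  | .sigma, l => ∃ p ∈ l, p.1.Sat v₁ ∧ p.2.Sat v₂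
  | .pi, l => ∀ p ∈ l, p.1.Sat v₁ ∨ p.2.Sat v₂

variable {v₁ : ℕ → Option A₁} {v₂ : ℕ → Option A₂}

theorem foldPairs_sat {K : Kind} {l : List (Fml τ × Fml τ)} :
    (foldPairs K l).Sat v₁ v₂ ↔ PairsSat v₁ v₂ K l := by
  induction l with
  | nil => cases K <;> simp [foldPairs, Comb.Sat, PairsSat]
  | cons p l ih => cases K <;> simp_all [foldPairs, Comb.Sat, PairsSat]

theorem normalForm_sat {K : Kind} {b : Comb τ} :
    PairsSat v₁ v₂ K (normalForm K b) ↔ b.Sat v₁ v₂ := by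
  induction b with
  | tru => cases K <;> simp [normalForm, Comb.Sat, PairsSat, Fml.Sat]
  | fls => cases K <;> simp [normalForm, Comb.Sat, PairsSat, Fml.Sat]
  | leaf s ψ => cases K <;> cases s <;> simp [normalForm, Comb.Sat, PairsSat, Fml.Sat, Kind.unit]
  | and α β ih ih' =>
    cases K
    · rw [normalForm, Comb.Sat, ← ih, ← ih']
      simp only [PairsSat, prodPairs, List.mem_flatMap, List.mem_map, Kind.conn]
      constructor
      · rintro ⟨_, ⟨p, hp, q, hq, rfl⟩, ⟨h₁, h₁'⟩, h₂, h₂'⟩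
        exact ⟨⟨p, hp, h₁, h₂⟩, q, hq, h₁', h₂'⟩
      · rintro ⟨⟨p, hp, h₁, h₂⟩, q, hq, h₁', h₂'⟩
        exact ⟨_, ⟨p, hp, q, hq, rfl⟩, ⟨h₁, h₁'⟩, h₂, h₂'⟩
    · rw [normalForm, Comb.Sat, ← ih, ← ih']
      simp only [PairsSat, List.forall_mem_append]
  | or α β ih ih' =>
    cases K
    · rw [normalForm, Comb.Sat, ← ih, ← ih']
      simp only [PairsSat, List.mem_append, or_and_right, exists_or]
    · rw [normalForm, Comb.Sat, ← ih, ← ih']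
      simp only [PairsSat, prodPairs, List.mem_flatMap, List.mem_map, Kind.conn]
      constructor
      · intro h
        by_contra! hc
        obtain ⟨⟨p, hp, h₁, h₂⟩, q, hq, h₁', h₂'⟩ := hc
        rcases h _ ⟨p, hp, q, hq, rfl⟩ with (h | h) | (h | h) <;> contradiction
      · rintro h _ ⟨p, hp, q, hq, rfl⟩
        rcases h with h | h
        · exact (h p hp).imp .inl .inl
        · exact (h q hq).imp .inr .inr

/-- An atom with variables on both sides is false in the union, which makes its negation true; both
flags hold only for an empty list of variables, and then the atom holds in the union iff it holds in
one of the summands. The negative literal is the De Morgan dual. -/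
theorem litComb_sat {pos a₁ a₂ : Bool} {ψ : Fml τ} {p₁ p₂ : Prop}
    (h₁ : a₁ = true → (ψ.Sat v₁ ↔ (p₁ ↔ pos = true)))
    (h₂ : a₂ = true → (ψ.Sat v₂ ↔ (p₂ ↔ pos = true))) :
    (litComb pos a₁ a₂ ψ).Sat v₁ v₂ ↔ ((a₁ = true ∧ p₁ ∨ a₂ = true ∧ p₂) ↔ pos = true) := by
  cases pos <;> cases a₁ <;> cases a₂ <;> simp_all [litComb, Comb.Sat]

theorem sat_rel_iff {L : FirstOrder.Language.{uF, uR}} {A : Type u} [L.Structure A]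
    {v : ℕ → Option A} {pos : Bool} {k : ℕ} {R : L.Relations k} {x : Fin k → ℕ} {a : Fin k → A}
    (h : ∀ i, v (x i) = some (a i)) :
    (Fml.rel pos R x).Sat v ↔ (FirstOrder.Language.Structure.RelMap R a ↔ pos = true) := by
  constructor
  · rintro ⟨b, hb, hR⟩
    obtain rfl : a = b := funext fun i => Option.some_injective _ ((h i).symm.trans (hb i))
    exact hR
  · exact fun hR => ⟨a, h, hR⟩

theorem sat_eq_iff {L : FirstOrder.Language.{uF, uR}} {A : Type u} [L.Structure A]
    {v : ℕ → Option A} {pos : Bool} {x y : ℕ} {a b : A} (hx : v x = some a) (hy : v y = some b) :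
    (Fml.eq pos x y : Fml L).Sat v ↔ (a = b ↔ pos = true) := by
  simp [Fml.Sat, hx, hy]

theorem comb_sat [τ.IsRelational] (φ : Fml (withP τ)) : ∀ (env : Sides) (v₁ : ℕ → Option A₁)
    (v₂ : ℕ → Option A₂), (∀ x ∈ φ.freeVars, (merge env v₁ v₂ x).isSome) →
    letI := annotatedUnion τ A₁ A₂
    (φ.Sat (merge env v₁ v₂) ↔ (comb φ env).Sat v₁ v₂) ∧
    ∀ K, (φ.Sat (merge env v₁ v₂) ↔ PairsSat v₁ v₂ K (pairs K φ env)) := by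
  intro env v₁ v₂ hv
  let := annotatedUnion τ A₁ A₂
  have plain {φ : Fml (withP τ)} {env : Sides} {v₁ : ℕ → Option A₁} {v₂ : ℕ → Option A₂} (K : Kind)
      (hφ : ¬ IsQuant K φ) (h : φ.Sat (merge env v₁ v₂) ↔ (comb φ env).Sat v₁ v₂) :
      φ.Sat (merge env v₁ v₂) ↔ PairsSat v₁ v₂ K (pairs K φ env) := by
    rw [pairs_of_not_isQuant hφ, normalForm_sat, h]
  have inl_of {env : Sides} {v₁ : ℕ → Option A₁} {v₂ : ℕ → Option A₂} {x : ℕ} {a : A₁ ⊕ A₂}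
      (h : merge env v₁ v₂ x = some a) (hs : env.side x = true) :
      ∃ b, a = .inl b ∧ v₁ x = some b := by
    simp only [merge, hs, if_true, Option.map_eq_some_iff] at h
    obtain ⟨b, hb, rfl⟩ := h
    exact ⟨b, rfl, hb⟩
  have inr_of {env : Sides} {v₁ : ℕ → Option A₁} {v₂ : ℕ → Option A₂} {x : ℕ} {a : A₁ ⊕ A₂}
      (h : merge env v₁ v₂ x = some a) (hs : env.side x = false) :
      ∃ b, a = .inr b ∧ v₂ x = some b := by
    simp only [merge, hs, Bool.false_eq_true, if_false, Option.map_eq_some_iff] at h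
    obtain ⟨b, hb, rfl⟩ := h
    exact ⟨b, rfl, hb⟩
  induction φ using Fml.quant_induction generalizing env v₁ v₂ with
  | tru => exact ⟨Iff.rfl, fun K => plain K id Iff.rfl⟩
  | fls => exact ⟨Iff.rfl, fun K => plain K id Iff.rfl⟩
  | @rel pos k R x =>
    suffices h : (Fml.rel pos R x).Sat (merge env v₁ v₂) ↔ (comb (.rel pos R x) env).Sat v₁ v₂ from
      ⟨h, fun K => plain K id h⟩
    -- At an undefined variable a literal is false in both polarities; only where all values exist
    -- does the negative literal complement the atom.
    have hv' : ∀ i, ∃ a, merge env v₁ v₂ (x i) = some a := fun i =>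
      Option.isSome_iff_exists.1 (hv (x i) ⟨i, rfl⟩)
    choose a ha using hv'
    rw [sat_rel_iff ha]
    rcases R with R | (R : AnnotRel _)
    · have h₁ : allSide env true (List.ofFn x) = true →
          ∃ b : Fin k → A₁, (∀ i, a i = .inl (b i)) ∧ ∀ i, v₁ (x i) = some (b i) := fun h => by
        choose b hb using fun i => inl_of (ha i) (allSide_eq_true.1 h (x i) (by simp))
        exact ⟨b, fun i => (hb i).1, fun i => (hb i).2⟩
      have h₂ : allSide env false (List.ofFn x) = true →
          ∃ b : Fin k → A₂, (∀ i, a i = .inr (b i)) ∧ ∀ i, v₂ (x i) = some (b i) := fun h => by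
        choose b hb using fun i => inr_of (ha i) (allSide_eq_true.1 h (x i) (by simp))
        exact ⟨b, fun i => (hb i).1, fun i => (hb i).2⟩
      have key := litComb_sat (pos := pos) (ψ := .rel pos R x) (v₁ := v₁) (v₂ := v₂)
        (a₁ := allSide env true (List.ofFn x)) (a₂ := allSide env false (List.ofFn x))
        (p₁ := ∃ b, (∀ i, a i = .inl (b i)) ∧ FirstOrder.Language.Structure.RelMap R b)
        (p₂ := ∃ b, (∀ i, a i = .inr (b i)) ∧ FirstOrder.Language.Structure.RelMap R b)
        (fun h => by
          obtain ⟨b, hb, hvb⟩ := h₁ h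
          rw [sat_rel_iff hvb]
          refine iff_congr ⟨fun h => ⟨b, hb, h⟩, ?_⟩ Iff.rfl
          rintro ⟨b', hb', h⟩
          obtain rfl : b = b' := funext fun i => Sum.inl_injective ((hb i).symm.trans (hb' i))
          exact h)
        (fun h => by
          obtain ⟨b, hb, hvb⟩ := h₂ h
          rw [sat_rel_iff hvb]
          refine iff_congr ⟨fun h => ⟨b, hb, h⟩, ?_⟩ Iff.rfl
          rintro ⟨b', hb', h⟩
          obtain rfl : b = b' := funext fun i => Sum.inr_injective ((hb i).symm.trans (hb' i))
          exact h)
      refine Iff.trans (iff_congr ?_ Iff.rfl) key.symm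
      have side_of {s : Bool} (h : ∀ i, env.side (x i) = s) :
          allSide env s (List.ofFn x) = true := by
        rw [allSide_eq_true]
        intro y hy
        obtain ⟨i, rfl⟩ := (List.mem_ofFn' _ _).1 hy
        exact h i
      change ((∃ b, (∀ i, a i = .inl (b i)) ∧ FirstOrder.Language.Structure.RelMap R b) ∨
        (∃ b, (∀ i, a i = .inr (b i)) ∧ FirstOrder.Language.Structure.RelMap R b)) ↔ _
      refine or_congr ?_ ?_
      · refine ⟨fun h => ⟨side_of fun i => ?_, h⟩, And.right⟩
        obtain ⟨b, hb, -⟩ := h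
        by_contra hs
        obtain ⟨c, hc, -⟩ := inr_of (ha i) (by simpa using hs)
        simp [hb i] at hc
      · refine ⟨fun h => ⟨side_of fun i => ?_, h⟩, And.right⟩
        obtain ⟨b, hb, -⟩ := h
        by_contra hs
        obtain ⟨c, hc, -⟩ := inl_of (ha i) (by simpa using hs)
        simp [hb i] at hc
    · cases R
      change ((∃ b : A₁, a 0 = .inl b) ↔ _) ↔
        Comb.Sat v₁ v₂ (if env.side (x 0) == pos then .tru else .fls)
      rcases hs : env.side (x 0) with _ | _
      · obtain ⟨b, hb, -⟩ := inr_of (ha 0) hs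
        cases pos <;> simp [hb, Comb.Sat]
      · obtain ⟨b, hb, -⟩ := inl_of (ha 0) hs
        cases pos <;> simp [hb, Comb.Sat]
  | eq pos x y =>
    suffices h : (Fml.eq pos x y : Fml (withP τ)).Sat (merge env v₁ v₂) ↔
        (comb (τ := τ) (.eq pos x y) env).Sat v₁ v₂ from ⟨h, fun K => plain K id h⟩
    obtain ⟨a, ha⟩ := Option.isSome_iff_exists.1 (hv x (.inl rfl))
    obtain ⟨b, hb⟩ := Option.isSome_iff_exists.1 (hv y (.inr rfl))
    rw [sat_eq_iff ha hb]
    have key := litComb_sat (τ := τ) (pos := pos) (ψ := .eq pos x y) (v₁ := v₁) (v₂ := v₂)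
        (a₁ := allSide env true [x, y]) (a₂ := allSide env false [x, y]) (p₁ := a = b) (p₂ := a = b)
        (fun h => by
          rw [allSide_eq_true] at h
          obtain ⟨c, rfl, hc⟩ := inl_of ha (h x (by simp))
          obtain ⟨d, rfl, hd⟩ := inl_of hb (h y (by simp))
          rw [sat_eq_iff hc hd, Sum.inl_injective.eq_iff])
        (fun h => by
          rw [allSide_eq_true] at h
          obtain ⟨c, rfl, hc⟩ := inr_of ha (h x (by simp))
          obtain ⟨d, rfl, hd⟩ := inr_of hb (h y (by simp))
          rw [sat_eq_iff hc hd, Sum.inr_injective.eq_iff])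
    refine Iff.trans (iff_congr ?_ Iff.rfl) key.symm
    simp only [allSide_eq_true, List.mem_cons, List.not_mem_nil, or_false, forall_eq_or_imp,
      forall_eq]
    rcases hx : env.side x with _ | _ <;> rcases hy : env.side y with _ | _ <;>
      simp only [reduceCtorEq, and_self, and_false, false_and, false_or, or_false, true_and,
        iff_self]
    · obtain ⟨c, rfl, -⟩ := inr_of ha hx
      obtain ⟨d, rfl, -⟩ := inl_of hb hy
      simp
    · obtain ⟨c, rfl, -⟩ := inl_of ha hx
      obtain ⟨d, rfl, -⟩ := inr_of hb hy
      simp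
  | and φ ψ ih ih' =>
    have h : (Fml.and φ ψ).Sat (merge env v₁ v₂) ↔ (comb (.and φ ψ) env).Sat v₁ v₂ :=
      and_congr (ih env v₁ v₂ fun x hx => hv x (.inl hx)).1
        (ih' env v₁ v₂ fun x hx => hv x (.inr hx)).1
    exact ⟨h, fun K => plain K id h⟩
  | or φ ψ ih ih' =>
    have h : (Fml.or φ ψ).Sat (merge env v₁ v₂) ↔ (comb (.or φ ψ) env).Sat v₁ v₂ :=
      or_congr (ih env v₁ v₂ fun x hx => hv x (.inl hx)).1
        (ih' env v₁ v₂ fun x hx => hv x (.inr hx)).1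
    exact ⟨h, fun K => plain K id h⟩
  | quant K z φ ih =>
    have hvu (a : A₁ ⊕ A₂) : ∀ x ∈ φ.freeVars,
        (Function.update (merge env v₁ v₂) z (some a) x).isSome := fun x hx => by
      by_cases h : x = z
      · subst h; simp
      · rw [Function.update_of_ne h]
        exact hv x (by rw [freeVars_quant]; exact ⟨hx, h⟩)
    have h₁ (a : A₁) := (ih ((true, z) :: env) (Function.update v₁ z (some a)) v₂
      (by rw [← update_merge_inl]; exact hvu (.inl a))).2 K
    have h₂ (a : A₂) := (ih ((false, z) :: env) v₁ (Function.update v₂ z (some a))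
      (by rw [← update_merge_inr]; exact hvu (.inr a))).2 K
    have hp : (K.quant z φ).Sat (merge env v₁ v₂) ↔
        PairsSat v₁ v₂ K (pairs K (K.quant z φ) env) := by
      rw [pairs_quant]
      cases K
      · simp only [Kind.quant, Fml.Sat, Sum.exists, update_merge_inl, update_merge_inr, h₁, h₂,
          PairsSat, List.mem_append, List.mem_map, or_and_right, exists_or, exists_exists_and_eq_and,
          quantPair, if_true, Bool.false_eq_true, if_false]
        -- For each summand one component does not depend on `a`, so the quantifier passes over it;
        -- no summand has to be nonempty.
        refine or_congr ?_ ?_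
        · exact ⟨fun ⟨a, p, hp, h, h'⟩ => ⟨p, hp, ⟨a, h⟩, h'⟩,
            fun ⟨p, hp, ⟨a, h⟩, h'⟩ => ⟨a, p, hp, h, h'⟩⟩
        · exact ⟨fun ⟨a, p, hp, h, h'⟩ => ⟨p, hp, h, a, h'⟩,
            fun ⟨p, hp, h, a, h'⟩ => ⟨a, p, hp, h, h'⟩⟩
      · simp only [Kind.quant, Fml.Sat, Sum.forall, update_merge_inl, update_merge_inr, h₁, h₂,
          PairsSat, List.forall_mem_append, List.forall_mem_map,
          quantPair, if_true, Bool.false_eq_true, if_false]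
        refine and_congr ?_ ?_
        · exact ⟨fun h p hp => or_iff_not_imp_right.2 fun hn a => (h a p hp).resolve_right hn,
            fun h a p hp => (h p hp).imp_left fun h => h a⟩
        · exact ⟨fun h p hp => or_iff_not_imp_left.2 fun hn a => (h a p hp).resolve_left hn,
            fun h a p hp => (h p hp).imp_right fun h => h a⟩
    have hb : (K.quant z φ).Sat (merge env v₁ v₂) ↔ (comb (K.quant z φ) env).Sat v₁ v₂ := by
      rw [hp, comb_quant, foldPairs_sat]
    refine ⟨hb, fun K' => ?_⟩
    by_cases h : K' = K
    · subst h; exact hp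
    · exact plain K' (by cases K <;> cases K' <;> simp_all [IsQuant, Kind.quant]) hb

end Semantics

end

/-! ### Towers of exponentials -/

theorem tower_mono (n : ℕ) : Monotone (tower n) := by
  induction n with
  | zero => exact monotone_id
  | succ n ih => exact fun a b h => Nat.pow_le_pow_right two_pos (ih h)

theorem tower_le_tower {n m a b : ℕ} (h : n ≤ m) (hab : a ≤ b) : tower n a ≤ tower m b :=
  (monotone_nat_of_le_succ (f := fun n => tower n a) (fun _ => Nat.lt_two_pow_self.le) h).trans
    (tower_mono m hab)

theorem le_tower (n a : ℕ) : a ≤ tower n a := tower_le_tower (n := 0) (Nat.zero_le n) le_rfl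

theorem tower_add_le (n a k : ℕ) : tower n a + k ≤ tower n (a + k) := by
  induction n with
  | zero => exact le_rfl
  | succ n ih =>
    have h : 2 ^ tower n a * 2 ^ k ≤ 2 ^ tower n (a + k) := by
      rw [← pow_add]; exact Nat.pow_le_pow_right two_pos ih
    have h₁ : 1 ≤ 2 ^ tower n a := Nat.one_le_two_pow
    have h₂ : k < 2 ^ k := Nat.lt_two_pow_self
    change 2 ^ tower n a + k ≤ 2 ^ tower n (a + k)
    nlinarith

/-- The extra 2 makes the induction close: 2^x + 2^y + 2 ≤ 4 · 2^x · 2^y. -/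
theorem tower_add_tower_le (n a b k : ℕ) : tower n a + tower n b + k ≤ tower n (a + b + 2 + k) := by
  have key : tower n a + tower n b + 2 ≤ tower n (a + b + 2) := by
    induction n with
    | zero => exact le_rfl
    | succ n ih =>
      have h := Nat.pow_le_pow_right two_pos ih
      rw [pow_add, pow_add] at h
      have h₁ : 1 ≤ 2 ^ tower n a := Nat.one_le_two_pow
      have h₂ : 1 ≤ 2 ^ tower n b := Nat.one_le_two_pow
      change 2 ^ tower n a + 2 ^ tower n b + 2 ≤ 2 ^ tower n (a + b + 2)
      nlinarith
  exact (Nat.add_le_add_right (by omega) k).trans (tower_add_le n (a + b + 2) k)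

/-- Moves the cost per call to the bottom of the tower. For T ≥ 1 and k ≥ 1, k ≤ 2^((k-1)T), hence k
· 2^T ≤ 2^(kT). -/
theorem mul_tower_le (n : ℕ) {a : ℕ} (k : ℕ) (ha : 1 ≤ a) : k * tower n a ≤ tower n (k * a) := by
  induction n with
  | zero => exact le_rfl
  | succ n ih =>
    rcases k.eq_zero_or_pos with rfl | hk
    · simp
    have h := Nat.pow_le_pow_right two_pos ih
    have hx : 1 ≤ tower n a := ha.trans (le_tower n a)
    obtain ⟨j, rfl⟩ : ∃ j, k = j + 1 := ⟨k - 1, by omega⟩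
    have h₁ : j + 1 ≤ 2 ^ (j * tower n a) :=
      (Nat.lt_two_pow_self (n := j)).trans_le
        (Nat.pow_le_pow_right two_pos (Nat.le_mul_of_pos_right j hx))
    calc (j + 1) * 2 ^ tower n a ≤ 2 ^ (j * tower n a) * 2 ^ tower n a := Nat.mul_le_mul_right _ h₁
      _ = 2 ^ ((j + 1) * tower n a) := by rw [← pow_add]; ring_nf
      _ ≤ _ := h

/-! ### Sizes -/

theorem Dat.one_le_size (d : Dat) : 1 ≤ d.size := by cases d <;> simp [Dat.size]

theorem Dat.size_tag (k : ℕ) : (Dat.tag k).size = 2 * k + 1 := by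
  induction k with
  | zero => rfl
  | succ k ih => simp only [Dat.tag, Dat.size, ih]; omega

theorem Dat.size_ofBool_le (b : Bool) : (Dat.ofBool b).size ≤ 3 := by cases b <;> simp [Dat.ofBool, Dat.size]

/-- The size of the representation of a formula. -/
def Fml.size {L : FirstOrder.Language.{uF, uR}} (sym : ∀ k, L.Relations k → Dat) (φ : Fml L) : ℕ :=
  (φ.enc sym).size

/-- The tree that represents a combination. -/
def Comb.enc {τ : FirstOrder.Language.{uF, uR}} (sym : ∀ k, τ.Relations k → Dat) : Comb τ → Dat
  | .tru => .cons (.tag 0) .nil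
  | .fls => .cons (.tag 1) .nil
  | .leaf true ψ => .cons (.tag 2) (.cons (.ofBool true) (ψ.enc sym))
  | .leaf false ψ => .cons (.tag 3) (.cons (.ofBool false) (ψ.enc sym))
  | .and α β => .cons (.tag 4) (.cons (α.enc sym) (β.enc sym))
  | .or α β => .cons (.tag 5) (.cons (α.enc sym) (β.enc sym))

/-- The size of the representation of a combination. -/
def Comb.size {τ : FirstOrder.Language.{uF, uR}} (sym : ∀ k, τ.Relations k → Dat) (b : Comb τ) : ℕ :=
  (b.enc sym).size

/-! ### Sizes of normal forms. -/

section

variable {L : FirstOrder.Language.{uF, uR}} (sym : ∀ k, L.Relations k → Dat)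

theorem Fml.three_le_size (φ : Fml L) : 3 ≤ φ.size sym := by
  have h (a b : Dat) : 3 ≤ (Dat.cons a b).size := by
    have := a.one_le_size
    have := b.one_le_size
    simp only [Dat.size]; omega
  cases φ <;> exact h _ _

theorem Kind.size_unit_le (K : Kind) : (K.unit : Fml L).size sym ≤ 5 := by
  cases K <;> simp [Kind.unit, Fml.size, Fml.enc, Dat.size, Dat.size_tag]

theorem Kind.size_conn_le (K : Kind) (φ ψ : Fml L) :
    (K.conn φ ψ).size sym ≤ φ.size sym + ψ.size sym + 13 := by
  cases K <;> simp [Kind.conn, Fml.size, Fml.enc, Dat.size, Dat.size_tag] <;> omega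

theorem Kind.size_quant_le (K : Kind) (z : ℕ) (φ : Fml L) :
    (K.quant z φ).size sym ≤ φ.size sym + (Dat.ofNat z).size + 17 := by
  cases K <;> simp [Kind.quant, Fml.size, Fml.enc, Dat.size, Dat.size_tag] <;> omega

theorem Kind.le_size_quant (K : Kind) (z : ℕ) (φ : Fml L) :
    φ.size sym + (Dat.ofNat z).size + 15 ≤ (K.quant z φ).size sym := by
  cases K <;> simp [Kind.quant, Fml.size, Fml.enc, Dat.size, Dat.size_tag] <;> omega

/-- The total size of the formulas of a normal form. -/
def pairsWeight : List (Fml L × Fml L) → ℕ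
  | [] => 0
  -- The 50 per pair makes the weight submultiplicative under `prodPairs`, and it covers the at most
  -- 48 nodes that `foldPairs` adds for a pair.
  | p :: l => p.1.size sym + p.2.size sym + 50 + pairsWeight l

theorem pairsWeight_append (l l' : List (Fml L × Fml L)) :
    pairsWeight sym (l ++ l') = pairsWeight sym l + pairsWeight sym l' := by
  induction l with
  | nil => simp [pairsWeight]
  | cons p l ih => simp only [List.cons_append, pairsWeight, ih]; omega

theorem length_le_pairsWeight (l : List (Fml L × Fml L)) : 50 * l.length ≤ pairsWeight sym l := by
  induction l with
  | nil => simp [pairsWeight]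
  | cons p l ih => simp only [List.length_cons, pairsWeight]; omega

theorem pairsWeight_prodPairs_le (K : Kind) (l l' : List (Fml L × Fml L)) :
    pairsWeight sym (prodPairs K l l') ≤ pairsWeight sym l * pairsWeight sym l' := by
  have row (p : Fml L × Fml L) (l' : List (Fml L × Fml L)) :
      pairsWeight sym (l'.map fun q => (K.conn p.1 q.1, K.conn p.2 q.2)) ≤
        (p.1.size sym + p.2.size sym + 50) * pairsWeight sym l' := by
    induction l' with
    | nil => simp [pairsWeight]
    | cons q l' ih =>
      have h₁ := K.size_conn_le sym p.1 q.1
      have h₂ := K.size_conn_le sym p.2 q.2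
      simp only [List.map_cons, pairsWeight]
      nlinarith [Nat.zero_le ((p.1.size sym + p.2.size sym) * (q.1.size sym + q.2.size sym))]
  induction l with
  | nil => simp [prodPairs, pairsWeight]
  | cons p l ih =>
    have := row p l'
    simp only [prodPairs, List.flatMap_cons, pairsWeight_append, pairsWeight] at ih ⊢
    rw [add_mul]
    omega

/-- A quantifier adds at most |z| + 17 to one component; thanks to the padding this is within a
factor |z| + 1 ≤ 2^|z|. -/
theorem pairsWeight_map_quantPair_le (s : Bool) (K : Kind) (z : ℕ) (l : List (Fml L × Fml L)) :
    pairsWeight sym (l.map (quantPair s K z)) ≤ pairsWeight sym l * 2 ^ (Dat.ofNat z).size := by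
  induction l with
  | nil => simp [pairsWeight]
  | cons p l ih =>
    have h₁ := K.size_quant_le sym z p.1
    have h₂ := K.size_quant_le sym z p.2
    have hz : (Dat.ofNat z).size + 1 ≤ 2 ^ (Dat.ofNat z).size := Nat.lt_two_pow_self
    have hz' := (Dat.ofNat z).one_le_size
    rw [List.map_cons, pairsWeight, pairsWeight, add_mul]
    refine Nat.add_le_add (le_trans ?_ (Nat.mul_le_mul_left _ hz)) ih
    cases s <;> simp only [quantPair, if_true, Bool.false_eq_true, if_false] <;> nlinarith

theorem two_pow_add_two_pow_le (a b : ℕ) : 2 ^ a + 2 ^ b ≤ 2 ^ (a + b + 1) := by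
  have h₁ : 1 ≤ 2 ^ a := Nat.one_le_two_pow
  have h₂ : 1 ≤ 2 ^ b := Nat.one_le_two_pow
  rw [pow_add, pow_add]
  nlinarith

theorem Comb.size_leaf (s : Bool) (ψ : Fml L) :
    ψ.size sym + 9 ≤ (Comb.leaf s ψ).size sym ∧ (Comb.leaf s ψ).size sym ≤ ψ.size sym + 12 := by
  cases s <;> simp [Fml.size, Comb.size, Comb.enc, Dat.size, Dat.size_tag, Dat.ofBool] <;> omega

theorem Comb.size_and (α β : Comb L) :
    (Comb.and α β).size sym = α.size sym + β.size sym + 11 := by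
  simp [Comb.size, Comb.enc, Dat.size, Dat.size_tag]; omega

theorem Comb.size_or (α β : Comb L) :
    (Comb.or α β).size sym = α.size sym + β.size sym + 13 := by
  simp [Comb.size, Comb.enc, Dat.size, Dat.size_tag]; omega

theorem Comb.size_tru : (Comb.tru : Comb L).size sym = 3 := rfl

theorem Comb.size_fls : (Comb.fls : Comb L).size sym = 5 := rfl

/-- Weights multiply under products and add under concatenation, whereas sizes of combinations add,
with some surplus, in both cases. -/
theorem pairsWeight_normalForm_le (K : Kind) (b : Comb L) :
    pairsWeight sym (normalForm K b) ≤ 2 ^ (2 * b.size sym) := by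
  have mul {a b : ℕ} {c : ℕ} {x y : ℕ} (hx : x ≤ 2 ^ (2 * a)) (hy : y ≤ 2 ^ (2 * b))
      (hc : a + b ≤ c) : x * y ≤ 2 ^ (2 * c) :=
    (Nat.mul_le_mul hx hy).trans (by
      rw [← pow_add]; exact Nat.pow_le_pow_right two_pos (by omega))
  have add {a b : ℕ} {c : ℕ} {x y : ℕ} (hx : x ≤ 2 ^ (2 * a)) (hy : y ≤ 2 ^ (2 * b))
      (hc : a + b + 1 ≤ c) : x + y ≤ 2 ^ (2 * c) :=
    (Nat.add_le_add hx hy).trans ((two_pow_add_two_pow_le _ _).trans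
      (Nat.pow_le_pow_right two_pos (by omega)))
  induction b with
  | tru => cases K <;> simp [normalForm, pairsWeight, Comb.size_tru, Fml.size, Fml.enc, Dat.size,
      Dat.size_tag]
  | fls => cases K <;> simp [normalForm, pairsWeight, Comb.size_fls, Fml.size, Fml.enc, Dat.size,
      Dat.size_tag]
  | leaf s ψ =>
    have h₁ := (Comb.size_leaf sym s ψ).1
    have h₂ := K.size_unit_le sym
    have h₃ : ψ.size sym < 2 ^ ψ.size sym := Nat.lt_two_pow_self
    have h₄ : 1 ≤ 2 ^ ψ.size sym := Nat.one_le_two_pow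
    have h₅ : 2 ^ (ψ.size sym + 6) ≤ 2 ^ (2 * (Comb.leaf s ψ).size sym) :=
      Nat.pow_le_pow_right two_pos (by omega)
    rw [pow_add] at h₅
    cases s <;> cases K <;> simp only [normalForm, pairsWeight] <;> omega
  | and α β ih ih' =>
    rw [Comb.size_and]
    cases K
    · exact (pairsWeight_prodPairs_le sym _ _ _).trans (mul ih ih' (by omega))
    · rw [normalForm, pairsWeight_append]; exact add ih ih' (by omega)
  | or α β ih ih' =>
    rw [Comb.size_or]
    cases K
    · rw [normalForm, pairsWeight_append]; exact add ih ih' (by omega)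
    · exact (pairsWeight_prodPairs_le sym _ _ _).trans (mul ih ih' (by omega))

theorem size_foldPairs_le (K : Kind) (l : List (Fml L × Fml L)) :
    (foldPairs K l).size sym ≤ pairsWeight sym l + 5 := by
  induction l with
  | nil => cases K <;> simp [foldPairs, pairsWeight, Comb.size_tru, Comb.size_fls]
  | cons p l ih =>
    have h₁ := (Comb.size_leaf sym true p.1).2
    have h₂ := (Comb.size_leaf sym false p.2).2
    cases K <;> simp only [foldPairs, Comb.size_and, Comb.size_or, pairsWeight] <;> omega

theorem size_litComb_le (pos a₁ a₂ : Bool) (ψ : Fml L) :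
    (litComb pos a₁ a₂ ψ).size sym ≤ 2 * ψ.size sym + 37 := by
  have h₁ := (Comb.size_leaf sym true ψ).2
  have h₂ := (Comb.size_leaf sym false ψ).2
  cases pos <;> cases a₁ <;> cases a₂ <;>
    simp [litComb, Comb.size_and, Comb.size_or, Comb.size_tru, Comb.size_fls] <;> omega

end

/-! ### Size of the reduction. -/

section

variable {τ : FirstOrder.Language.{uF, uR}} (code : (Σ k, τ.Relations k) → ℕ)

theorem pairsWeight_pairs_quant_le {K : Kind} {z : ℕ} {φ : Fml (withP τ)} {e : ℕ}
    (h : ∀ env, pairsWeight (symDat code) (pairs K φ env) ≤ 2 ^ e) (env : Sides) :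
    pairsWeight (symDat code) (pairs K (K.quant z φ) env) ≤ 2 ^ (e + (Dat.ofNat z).size + 1) := by
  rw [pairs_quant, pairsWeight_append, pow_succ, pow_add, mul_two]
  exact Nat.add_le_add
    ((pairsWeight_map_quantPair_le _ _ _ _ _).trans (Nat.mul_le_mul_right _ (h _)))
    ((pairsWeight_map_quantPair_le _ _ _ _ _).trans (Nat.mul_le_mul_right _ (h _)))

/-- The pairs are one exponential above a tower of height `coreDepth`, the combination is a tower of
height `depth`. The factor 4 leaves room for the exponent 2|b| of the normal form, for the running
time of that normal form, and for the entries that accompany β. -/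
theorem size_comb_le (φ : Fml (withP τ)) :
    (∀ env, 4 * (comb φ env).size (symDat code) ≤
      tower (depth φ) (100 * φ.size (symDatP code))) ∧
    ∀ K env, pairsWeight (symDat code) (pairs K φ env) ≤
      2 ^ tower (coreDepth K φ) (100 * φ.size (symDatP code)) := by
  have plain {φ : Fml (withP τ)} (K : Kind) (hφ : ¬ IsQuant K φ)
      (h : ∀ env, 4 * (comb φ env).size (symDat code) ≤
        tower (depth φ) (100 * φ.size (symDatP code))) (env : Sides) :
      pairsWeight (symDat code) (pairs K φ env) ≤
        2 ^ tower (coreDepth K φ) (100 * φ.size (symDatP code)) := by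
    rw [pairs_of_not_isQuant hφ, coreDepth_of_not_isQuant hφ]
    refine (pairsWeight_normalForm_le _ _ _).trans (Nat.pow_le_pow_right two_pos ?_)
    have := h env
    omega
  have small {φ : Fml (withP τ)} {env : Sides}
      (h : (comb φ env).size (symDat code) ≤ 2 * φ.size (symDatP code) + 37) :
      4 * (comb φ env).size (symDat code) ≤ tower (depth φ) (100 * φ.size (symDatP code)) := by
    have h₁ := φ.three_le_size (symDatP code)
    exact le_trans (by omega) (le_tower _ _)
  have join {φ ψ χ : Fml (withP τ)} {env : Sides} (hd : depth χ = max (depth φ) (depth ψ))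
      (h : 4 * (comb φ env).size (symDat code) ≤ tower (depth φ) (100 * φ.size (symDatP code)))
      (h' : 4 * (comb ψ env).size (symDat code) ≤ tower (depth ψ) (100 * ψ.size (symDatP code)))
      (hs : φ.size (symDatP code) + ψ.size (symDatP code) + 11 ≤ χ.size (symDatP code)) :
      4 * ((comb φ env).size (symDat code) + (comb ψ env).size (symDat code) + 13) ≤
        tower (depth χ) (100 * χ.size (symDatP code)) := by
    have h₁ := h.trans (tower_le_tower (hd ▸ le_max_left _ _ : depth φ ≤ depth χ) le_rfl)
    have h₂ := h'.trans (tower_le_tower (hd ▸ le_max_right _ _ : depth ψ ≤ depth χ) le_rfl)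
    have h₃ := tower_add_tower_le (depth χ) (100 * φ.size (symDatP code))
      (100 * ψ.size (symDatP code)) 52
    have h₄ : tower (depth χ) _ ≤ tower (depth χ) (100 * χ.size (symDatP code)) :=
      tower_mono (depth χ) (show 100 * φ.size (symDatP code) + 100 * ψ.size (symDatP code) + 2 + 52
        ≤ 100 * χ.size (symDatP code) by omega)
    omega
  induction φ using Fml.quant_induction with
  | tru =>
    have h : ∀ env, _ := fun env => small (φ := .tru) (env := env) (by
      simp [comb, reduce, plainResult, Comb.size_tru])
    exact ⟨h, fun K => plain K id h⟩
  | fls =>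
    have h : ∀ env, _ := fun env => small (φ := .fls) (env := env) (by
      simp [comb, reduce, plainResult, Comb.size_fls])
    exact ⟨h, fun K => plain K id h⟩
  | rel pos R x =>
    have h : ∀ env, _ := fun env => small (φ := .rel pos R x) (env := env) (by
      rcases R with R | (R : AnnotRel _)
      · exact size_litComb_le _ _ _ _ _
      · cases R
        simp only [comb, reduce, plainResult, relComb]
        split <;> simp only [Comb.size_tru, Comb.size_fls] <;> omega)
    exact ⟨h, fun K => plain K id h⟩
  | eq pos x y =>
    have h : ∀ env, _ := fun env => small (φ := .eq pos x y) (env := env)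
      (size_litComb_le _ _ _ _ _)
    exact ⟨h, fun K => plain K id h⟩
  | and φ ψ ih ih' =>
    have h : ∀ env, 4 * (comb (.and φ ψ) env).size (symDat code) ≤ _ := fun env =>
      le_trans (Nat.mul_le_mul_left 4 (by
        change (Comb.and (comb φ env) (comb ψ env)).size (symDat code) ≤ _
        rw [Comb.size_and]
        exact Nat.add_le_add_left (by norm_num) _))
        (join (χ := .and φ ψ) rfl (ih.1 env) (ih'.1 env) (by
          simp [Fml.size, Fml.enc, Dat.size, Dat.size_tag]; omega))
    exact ⟨h, fun K => plain K id h⟩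
  | or φ ψ ih ih' =>
    have h : ∀ env, 4 * (comb (.or φ ψ) env).size (symDat code) ≤ _ := fun env =>
      le_trans (Nat.mul_le_mul_left 4 (by
        change (Comb.or (comb φ env) (comb ψ env)).size (symDat code) ≤ _
        rw [Comb.size_or]))
        (join (χ := .or φ ψ) rfl (ih.1 env) (ih'.1 env) (by
          simp [Fml.size, Fml.enc, Dat.size, Dat.size_tag]; omega))
    exact ⟨h, fun K => plain K id h⟩
  | quant K z φ ih =>
    have hz := K.le_size_quant (symDatP code) z φ
    -- In the exponent, |z| pays for the new quantifiers, 1 for the two sides, and 5 for the final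
    -- summand of `size_foldPairs_le`.
    have hp : ∀ env, pairsWeight (symDat code) (pairs K (K.quant z φ) env) + 5 ≤
        2 ^ tower (coreDepth K φ) (100 * φ.size (symDatP code) + (Dat.ofNat z).size + 6) :=
      fun env => by
        have h₁ := pairsWeight_pairs_quant_le code (ih.2 K) (z := z) env
        have h₂ := tower_add_le (coreDepth K φ) (100 * φ.size (symDatP code))
          ((Dat.ofNat z).size + 6)
        refine (Nat.add_le_add_right h₁ 5).trans
          (le_trans ?_ (Nat.pow_le_pow_right two_pos h₂))
        have h₃ : 1 ≤ 2 ^ (tower (coreDepth K φ) (100 * φ.size (symDatP code)) +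
          (Dat.ofNat z).size + 1) := Nat.one_le_two_pow
        rw [show ∀ a b : ℕ, a + (b + 6) = a + b + 1 + 5 from fun _ _ => rfl, pow_add _ _ 5]
        omega
    -- The depth is the core depth plus one, so the exponential of the bound for the pairs is a
    -- tower of exactly the right height. The factor 4 costs 2 more in the exponent, all paid by the
    -- at least |z| + 15 nodes of the quantifier.
    have hb : ∀ env, 4 * (comb (K.quant z φ) env).size (symDat code) ≤
        tower (depth (K.quant z φ)) (100 * (K.quant z φ).size (symDatP code)) := fun env => by
      rw [comb_quant, depth_quant]
      have h₁ := size_foldPairs_le (symDat code) K (pairs K (K.quant z φ) env)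
      have h₂ := tower_add_le (coreDepth K φ)
        (100 * φ.size (symDatP code) + (Dat.ofNat z).size + 6) 2
      calc _ ≤ 2 ^ (_ + 2) := by
              rw [pow_add, mul_comm]
              exact Nat.mul_le_mul_right 4 (h₁.trans (hp env))
        _ ≤ 2 ^ _ := Nat.pow_le_pow_right two_pos h₂
        _ ≤ _ := Nat.pow_le_pow_right two_pos (tower_mono _ (by omega))
    refine ⟨hb, fun K' => ?_⟩
    by_cases h : K' = K
    · subst h
      -- The core depth is unchanged by a quantifier of its own kind: a whole block costs a single
      -- exponential.
      rw [coreDepth_quant]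
      exact fun env => (Nat.le_add_right _ 5).trans ((hp env).trans
        (Nat.pow_le_pow_right two_pos (tower_mono _ (by omega))))
    · exact plain K' (by cases K <;> cases K' <;> simp_all [IsQuant, Kind.quant]) hb

end

/-! ### Reasoning about programs -/

namespace Exp

/-- The number of nodes. -/
def nodes : Exp → ℕ
  | var _ => 1
  | nil => 1
  | cons a b => a.nodes + b.nodes + 1
  | head e => e.nodes + 1
  | tail e => e.nodes + 1
  | ite c a b => c.nodes + a.nodes + b.nodes + 1
  | letE e b => e.nodes + b.nodes + 1
  | call _ e => e.nodes + 1

/-- There are no calls and no local definitions, and the only variable is `var 0`. -/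
def isPure : Exp → Bool
  | var i => i == 0
  | nil => true
  | cons a b => a.isPure && b.isPure
  | head e => e.isPure
  | tail e => e.isPure
  | ite c a b => c.isPure && a.isPure && b.isPure
  | letE _ _ => false
  | call _ _ => false

/-- The value of a pure expression. -/
def val (x : Dat) : Exp → Dat
  | var _ => x
  | nil => .nil
  | cons a b => .cons (a.val x) (b.val x)
  | head e => (e.val x).head
  | tail e => (e.val x).tail
  | ite c a b => match c.val x with
    | .nil => b.val x
    | .cons _ _ => a.val x
  | letE _ _ => .nil
  | call _ _ => .nil

/-- A numeral in unary, as an expression. -/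
def tag : ℕ → Exp
  | 0 => nil
  | k + 1 => cons nil (tag k)

/-- Case distinction on a numeral in unary. -/
def cases (t : Exp) : List Exp → Exp
  | [] => nil
  | [e] => e
  | e :: e' :: l => ite t (cases (tail t) (e' :: l)) e

end Exp

/-- A bound on the number of nodes of a function body. -/
def bodyBound : ℕ := 1000

/-- The function number `f` maps `d` to `d'`, with at most `N` function calls in total. -/
def Calls (P : Program) (f : ℕ) (d d' : Dat) (N : ℕ) : Prop :=
  ∃ body t, P[f]? = some body ∧ Eval P [d] body d' t ∧ t ≤ bodyBound * N

/-- The expression `e` evaluates to `d`, with at most `N` function calls in total. -/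
def Runs (P : Program) (x : Dat) (e : Exp) (d : Dat) (N : ℕ) : Prop :=
  ∃ t, Eval P [x] e d t ∧ t ≤ e.nodes + bodyBound * N

section

variable {P : Program} {x : Dat}

/-- Apart from calls, a body is traversed with each node visited at most once, so its own cost is at
most `bodyBound` and time is measured by counting calls. The `+ 1` is the call itself. -/
theorem Calls.intro {f : ℕ} {body : Exp} {d d' : Dat} {C N : ℕ} (hf : P[f]? = some body)
    (hn : body.nodes ≤ bodyBound) (h : Runs P d body d' C) (hN : C + 1 ≤ N) : Calls P f d d' N := by
  obtain ⟨t, ht, hle⟩ := h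
  refine ⟨body, t, hf, ht, ?_⟩
  have := Nat.mul_le_mul_left bodyBound hN
  rw [mul_add, mul_one] at this
  omega

/-- Call-free expressions are evaluated by `val`, so their correctness reduces to `rfl` and they
contribute no calls. -/
theorem Runs.pure {e : Exp} {d : Dat} (he : e.isPure = true) (hd : e.val x = d) :
    Runs P x e d 0 := by
  subst hd
  induction e with
  | var i => exact ⟨1, .var (by simp_all [Exp.isPure, Exp.val]), Nat.le_refl _⟩
  | nil => exact ⟨1, .nil, Nat.le_refl _⟩
  | cons a b iha ihb =>
    simp only [Exp.isPure, Bool.and_eq_true] at he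
    obtain ⟨s, hs, hs'⟩ := iha he.1
    obtain ⟨t, ht, ht'⟩ := ihb he.2
    exact ⟨_, .cons hs ht, by simp only [Exp.nodes]; omega⟩
  | head e ih =>
    obtain ⟨s, hs, hs'⟩ := ih he
    exact ⟨_, .head hs, by simp only [Exp.nodes]; omega⟩
  | tail e ih =>
    obtain ⟨s, hs, hs'⟩ := ih he
    exact ⟨_, .tail hs, by simp only [Exp.nodes]; omega⟩
  | ite c a b ihc iha ihb =>
    simp only [Exp.isPure, Bool.and_eq_true] at he
    obtain ⟨r, hr, hr'⟩ := ihc he.1.1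
    obtain ⟨s, hs, hs'⟩ := iha he.1.2
    obtain ⟨t, ht, ht'⟩ := ihb he.2
    simp only [Exp.val]
    split
    · rename_i h
      rw [h] at hr
      exact ⟨_, .ite_false hr ht, by simp only [Exp.nodes]; omega⟩
    · rename_i h
      rw [h] at hr
      exact ⟨_, .ite_true hr hs, by simp only [Exp.nodes]; omega⟩
  | letE e b => cases he
  | call f e => cases he

theorem Runs.cons {a b : Exp} {d d' : Dat} {M N : ℕ} (ha : Runs P x a d M) (hb : Runs P x b d' N) :
    Runs P x (.cons a b) (.cons d d') (M + N) := by
  obtain ⟨s, hs, hs'⟩ := ha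
  obtain ⟨t, ht, ht'⟩ := hb
  exact ⟨_, .cons hs ht, by simp only [Exp.nodes, mul_add]; omega⟩

theorem Runs.ite_true {c a b : Exp} {d₁ d₂ d : Dat} {M N : ℕ} (hc : Runs P x c (.cons d₁ d₂) M)
    (ha : Runs P x a d N) : Runs P x (.ite c a b) d (M + N) := by
  obtain ⟨s, hs, hs'⟩ := hc
  obtain ⟨t, ht, ht'⟩ := ha
  exact ⟨_, .ite_true hs ht, by simp only [Exp.nodes, mul_add]; omega⟩

theorem Runs.ite_false {c a b : Exp} {d : Dat} {M N : ℕ} (hc : Runs P x c .nil M)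
    (hb : Runs P x b d N) : Runs P x (.ite c a b) d (M + N) := by
  obtain ⟨s, hs, hs'⟩ := hc
  obtain ⟨t, ht, ht'⟩ := hb
  exact ⟨_, .ite_false hs ht, by simp only [Exp.nodes, mul_add]; omega⟩

theorem Runs.call {f : ℕ} {e : Exp} {d d' : Dat} {M N : ℕ} (h : Calls P f d d' N)
    (he : Runs P x e d M) : Runs P x (.call f e) d' (M + N) := by
  obtain ⟨s, hs, hs'⟩ := he
  obtain ⟨body, t, hf, ht, ht'⟩ := h
  exact ⟨_, .call hf hs ht, by simp only [Exp.nodes, mul_add]; omega⟩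

end

/-! ### The program -/

namespace Prog

/-- The truth value `true`. -/
def yes : Exp := .cons .nil .nil

/-- The argument of the current function. -/
def arg : Exp := .var 0

/-- The representation of the formula (or combination) `True`. -/
def truE : Exp := .cons (.tag 0) .nil

/-- The representation of the formula (or combination) `False`. -/
def flsE : Exp := .cons (.tag 1) .nil

/-- The leaf for the first structure. -/
def leaf₁ (e : Exp) : Exp := .cons (.tag 2) (.cons yes e)

/-- The leaf for the second structure. -/
def leaf₂ (e : Exp) : Exp := .cons (.tag 3) (.cons .nil e)

/-- The main function. -/
def mainBody : Exp := .call 15 (.call 6 (.cons (.head arg) (.call 1 (.head (.tail arg)))))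

/-- The list of the sides of the given variables of the first structure. -/
def initBody : Exp :=
  .ite arg (.cons (.cons yes (.head arg)) (.call 1 (.tail arg))) .nil

/-- Equality of two trees. -/
def eqBody : Exp :=
  .ite (.head arg)
    (.ite (.tail arg)
      (.ite (.call 2 (.cons (.head (.head arg)) (.head (.tail arg))))
        (.call 2 (.cons (.tail (.head arg)) (.tail (.tail arg)))) .nil) .nil)
    (.ite (.tail arg) .nil yes)

/-- The side of a variable. -/
def sideBody : Exp :=
  .ite (.head arg)
    (.ite (.call 2 (.cons (.tail (.head (.head arg))) (.tail arg))) (.head (.head (.head arg)))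
      (.call 3 (.cons (.tail (.head arg)) (.tail arg)))) .nil

/-- Whether all variables of a list are on the given side. -/
def allSideBody : Exp :=
  let rest : Exp := .call 4 (.cons (.head arg) (.cons (.head (.tail arg)) (.tail (.tail (.tail arg)))))
  .ite (.tail (.tail arg))
    (.ite (.call 3 (.cons (.head (.tail arg)) (.head (.tail (.tail arg)))))
      (.ite (.head arg) rest .nil) (.ite (.head arg) .nil rest)) yes

/-- The reduction of a literal with a given list of variables. -/
def litBody : Exp :=
  let c₁ : Exp := .call 4 (.cons yes (.tail arg))
  let c₂ : Exp := .call 4 (.cons .nil (.tail arg))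
  .ite (.head (.tail (.head arg)))
    (.cons (.tag 5) (.cons (.ite c₁ (leaf₁ (.head arg)) flsE) (.ite c₂ (leaf₂ (.head arg)) flsE)))
    (.cons (.tag 4) (.cons (.ite c₁ (leaf₁ (.head arg)) truE) (.ite c₂ (leaf₂ (.head arg)) truE)))

/-- The reduction of a formula. -/
def combBody : Exp :=
  let φ : Exp := .head arg
  let env : Exp := .tail arg
  let pos : Exp := .head (.tail φ)
  let join : Exp := .cons (.head φ) (.cons (.call 6 (.cons (.head (.tail φ)) env))
    (.call 6 (.cons (.tail (.tail φ)) env)))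
  -- Formulas and combinations share the codes of the constants and the tags of the connectives, so
  -- constants are returned unchanged and connectives keep their tag.
  .cases (.head φ) [φ, φ,
    -- The test separates the symbols of τ, whose codes are pairs, from `P`, whose code is `nil`.
    .ite (.head (.tail (.tail φ))) (.call 5 (.cons φ (.cons env (.tail (.tail (.tail φ))))))
      (.ite (.call 3 (.cons env (.head (.tail (.tail (.tail φ))))))
        (.ite pos truE flsE) (.ite pos flsE truE)),
    .call 5 (.cons φ (.cons env (.cons (.head (.tail (.tail φ)))
      (.cons (.tail (.tail (.tail φ))) .nil)))),
    join, join,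
    .call 13 (.cons yes (.call 7 (.cons yes arg))), .call 13 (.cons .nil (.call 7 (.cons .nil arg)))]

/-- The normal form of a formula with the outermost quantifiers pulled in. -/
def pairsBody : Exp :=
  let K : Exp := .head arg
  let φ : Exp := .head (.tail arg)
  let env : Exp := .tail (.tail arg)
  let z : Exp := .head (.tail φ)
  let rec' (s : Exp) : Exp := .call 7 (.cons K (.cons (.tail (.tail φ)) (.cons (.cons s z) env)))
  .ite (.call 2 (.cons (.head φ) (.ite K (.tag 6) (.tag 7))))
    (.call 8 (.cons (.cons yes (.cons K z)) (.cons (rec' yes)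
      (.call 8 (.cons (.cons .nil (.cons K z)) (.cons (rec' .nil) .nil))))))
    (.call 12 (.cons K (.call 6 (.cons φ env))))

/-- Quantification of the components on one side, followed by a given list. -/
def mapQuantBody : Exp :=
  let s : Exp := .head (.head arg)
  let K : Exp := .head (.tail (.head arg))
  let z : Exp := .tail (.tail (.head arg))
  let l : Exp := .head (.tail arg)
  let acc : Exp := .tail (.tail arg)
  let quant (e : Exp) : Exp := .cons (.ite K (.tag 6) (.tag 7)) (.cons z e)
  .ite l
    (.cons (.ite s (.cons (quant (.head (.head l))) (.tail (.head l)))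
      (.cons (.head (.head l)) (quant (.tail (.head l)))))
      (.call 8 (.cons (.head arg) (.cons (.tail l) acc)))) acc

/-- Concatenation. -/
def appendBody : Exp :=
  .ite (.head arg) (.cons (.head (.head arg)) (.call 9 (.cons (.tail (.head arg)) (.tail arg))))
    (.tail arg)

/-- The products of a pair with the pairs of a list, followed by a given list. -/
def prodRowBody : Exp :=
  let K : Exp := .head (.head arg)
  let p : Exp := .tail (.head arg)
  let l : Exp := .head (.tail arg)
  let acc : Exp := .tail (.tail arg)
  let conn (a b : Exp) : Exp := .cons (.ite K (.tag 4) (.tag 5)) (.cons a b)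
  .ite l
    (.cons (.cons (conn (.head p) (.head (.head l))) (conn (.tail p) (.tail (.head l))))
      (.call 10 (.cons (.head arg) (.cons (.tail l) acc)))) acc

/-- The products of the pairs of two lists. -/
def prodBody : Exp :=
  let K : Exp := .head arg
  let l : Exp := .head (.tail arg)
  let l' : Exp := .tail (.tail arg)
  .ite l (.call 10 (.cons (.cons K (.head l)) (.cons l' (.call 11 (.cons K (.cons (.tail l) l'))))))
    .nil

/-- Normal forms of combinations. -/
def normalFormBody : Exp :=
  let K : Exp := .head arg
  let b : Exp := .tail arg
  let unit : Exp := .ite K truE flsE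
  let r₁ : Exp := .call 12 (.cons K (.head (.tail b)))
  let r₂ : Exp := .call 12 (.cons K (.tail (.tail b)))
  let prod : Exp := .call 11 (.cons K (.cons r₁ r₂))
  let append : Exp := .call 9 (.cons r₁ r₂)
  .cases (.head b) [.ite K (.cons (.cons truE truE) .nil) .nil,
    .ite K .nil (.cons (.cons flsE flsE) .nil),
    .cons (.cons (.tail (.tail b)) unit) .nil, .cons (.cons unit (.tail (.tail b))) .nil,
    .ite K prod append, .ite K append prod]

/-- The combination that a normal form stands for. -/
def foldBody : Exp :=
  let K : Exp := .head arg
  let l : Exp := .tail arg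
  .ite l
    (.cons (.ite K (.tag 5) (.tag 4))
      (.cons (.cons (.ite K (.tag 4) (.tag 5))
        (.cons (leaf₁ (.head (.head l))) (leaf₂ (.tail (.head l)))))
        (.call 13 (.cons K (.tail l)))))
    (.ite K flsE truE)

/-- The entries of the leaves of a combination, followed by a given list. -/
def entriesBody : Exp :=
  let b : Exp := .head arg
  let acc : Exp := .tail arg
  let join : Exp := .call 14 (.cons (.head (.tail b)) (.call 14 (.cons (.tail (.tail b)) acc)))
  .cases (.head b) [acc, acc,
    -- The index is the code of the leaf without its tag: the side together with the formula.
    .cons (.cons (.tail b) (.cons (.tail (.tail b)) truE)) acc,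
    .cons (.cons (.tail b) (.cons truE (.tail (.tail b)))) acc, join, join]

/-- The reduction sequence of a combination. -/
def finishBody : Exp := .cons (.call 14 (.cons arg .nil)) arg

/-- The program that computes the reduction sequences. -/
def reduction : Program :=
  [mainBody, initBody, eqBody, sideBody, allSideBody, litBody, combBody, pairsBody, mapQuantBody,
    appendBody, prodRowBody, prodBody, normalFormBody, foldBody, entriesBody, finishBody]

end Prog

open Prog

/-! ### Representations of the intermediate data -/

/-- The tree that represents the sides of variables. -/
def Sides.enc (env : Sides) : Dat := .ofList (env.map fun e => .cons (.ofBool e.1) (.ofNat e.2))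

theorem encVars_cons (x : ℕ) (xs : List ℕ) : encVars (x :: xs) = .cons (.ofNat x) (encVars xs) := rfl

/-- The tree that represents the kind of a quantifier. -/
def Kind.enc : Kind → Dat
  | .sigma => .ofBool true
  | .pi => .ofBool false

/-- The tree that represents a list of pairs of formulas. -/
def encPairs {L : FirstOrder.Language.{uF, uR}} (sym : ∀ k, L.Relations k → Dat)
    (l : List (Fml L × Fml L)) : Dat :=
  .ofList (l.map fun p => .cons (p.1.enc sym) (p.2.enc sym))

/-- The entries of a reduction sequence for the leaves of a combination. -/
def Comb.entries {L : FirstOrder.Language.{uF, uR}} (sym : ∀ k, L.Relations k → Dat) :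
    Comb L → List (Dat × Fml L × Fml L)
  | .tru => []
  | .fls => []
  | .leaf true ψ => [(.cons (.ofBool true) (ψ.enc sym), ψ, .tru)]
  | .leaf false ψ => [(.cons (.ofBool false) (ψ.enc sym), .tru, ψ)]
  | .and α β => α.entries sym ++ β.entries sym
  | .or α β => α.entries sym ++ β.entries sym

/-- The tree that represents a list of entries. -/
def encEntries {L : FirstOrder.Language.{uF, uR}} (sym : ∀ k, L.Relations k → Dat)
    (l : List (Dat × Fml L × Fml L)) : Dat :=
  .ofList (l.map fun e => .cons e.1 (.cons (e.2.1.enc sym) (e.2.2.enc sym)))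

theorem Dat.ofBool_injective : Function.Injective Dat.ofBool := by
  intro a b h
  cases a <;> cases b <;> first | rfl | cases h

theorem Dat.ofList_injective : Function.Injective Dat.ofList := by
  intro l
  induction l with
  | nil => intro l' h; cases l' <;> first | rfl | cases h
  | cons d l ih =>
    intro l' h
    cases l' with
    | nil => cases h
    | cons d' l' =>
      simp only [Dat.ofList, Dat.cons.injEq] at h
      rw [h.1, ih h.2]

theorem Dat.ofNat_injective : Function.Injective Dat.ofNat := by
  intro m n h
  have := List.map_injective_iff.2 Dat.ofBool_injective (Dat.ofList_injective h)
  exact Nat.digits_inj_iff (b := 2).1 (by rw [Nat.digits_two_eq_bits, Nat.digits_two_eq_bits, this])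

/-! ### Correctness and running time of the functions -/

/-- The comparison descends simultaneously in both trees and so is bounded by the first one alone;
comparing with a constructor tag takes constant time. -/
theorem treeEq_calls (a : Dat) : ∀ b, (a = b → Calls reduction 2 (.cons a b) (.ofBool true) a.size) ∧
    (a ≠ b → Calls reduction 2 (.cons a b) (.ofBool false) a.size) := by
  induction a with
  | nil =>
    intro b
    cases b with
    | nil =>
      exact ⟨fun _ => .intro rfl (by decide) (.ite_false (.pure rfl rfl) (.pure rfl rfl)) le_rfl,
        fun h => absurd rfl h⟩
    | cons c d =>
      exact ⟨fun h => (nomatch h), fun _ =>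
        .intro rfl (by decide) (.ite_false (.pure rfl rfl) (.pure rfl rfl)) le_rfl⟩
  | cons c d ih ih' =>
    intro b
    cases b with
    | nil =>
      exact ⟨fun h => (nomatch h), fun _ => .intro rfl (by decide)
        (.ite_true (.pure rfl rfl) (.ite_false (.pure rfl rfl) (.pure rfl rfl)))
        (by simp [Dat.size])⟩
    | cons c' d' =>
      refine ⟨fun h => ?_, fun h => ?_⟩
      · cases h
        exact .intro rfl (by decide) (.ite_true (.pure rfl rfl) (.ite_true (.pure rfl rfl)
          (.ite_true (.call ((ih c).1 rfl) (.pure rfl rfl))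
            (.call ((ih' d).1 rfl) (.pure rfl rfl))))) (by simp only [Dat.size]; omega)
      · by_cases hc : c = c'
        · have hd : d ≠ d' := fun hd => h (by rw [hc, hd])
          exact .intro rfl (by decide) (.ite_true (.pure rfl rfl) (.ite_true (.pure rfl rfl)
            (.ite_true (.call ((ih c').1 hc) (.pure rfl rfl))
              (.call ((ih' d').2 hd) (.pure rfl rfl))))) (by simp only [Dat.size]; omega)
        · exact .intro rfl (by decide) (.ite_true (.pure rfl rfl) (.ite_true (.pure rfl rfl)
            (.ite_false (.call ((ih c').2 hc) (.pure rfl rfl)) (.pure rfl rfl))))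
            (by simp only [Dat.size]; omega)

/-- Only the first tuple is listed, since variables without an entry count as belonging to the
second structure. -/
theorem init_calls (xs : List ℕ) :
    Calls reduction 1 (encVars xs) (Sides.enc (xs.map fun x => (true, x))) (xs.length + 1) := by
  induction xs with
  | nil => exact .intro rfl (by decide) (.ite_false (.pure rfl rfl) (.pure rfl rfl)) le_rfl
  | cons x xs ih =>
    exact .intro rfl (by decide) (.ite_true (.pure rfl rfl)
      (.cons (.pure rfl rfl) (.call ih (.pure rfl rfl)))) (by simp)

/-- Each comparison is charged to the variable stored in the list, so a full scan costs no more than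
the size of the list. -/
theorem side_calls (env : Sides) (x : ℕ) :
    Calls reduction 3 (.cons (Sides.enc env) (.ofNat x)) (.ofBool (env.side x)) (Sides.enc env).size := by
  induction env with
  | nil => exact .intro rfl (by decide) (.ite_false (.pure rfl rfl) (.pure rfl rfl)) le_rfl
  | cons e env ih =>
    obtain ⟨s, y⟩ := e
    have hs : Sides.enc ((s, y) :: env) = .cons (.cons (.ofBool s) (.ofNat y)) (Sides.enc env) := rfl
    rw [hs]
    by_cases h : y = x
    · subst h
      rw [Sides.side, if_pos rfl]
      exact .intro rfl (by decide) (.ite_true (.pure rfl rfl) (.ite_true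
        (.call ((treeEq_calls (.ofNat y) (.ofNat y)).1 rfl) (.pure rfl rfl)) (.pure rfl rfl)))
        (by simp only [Dat.size]; omega)
    · rw [Sides.side, if_neg h]
      exact .intro rfl (by decide) (.ite_true (.pure rfl rfl) (.ite_false
        (.call ((treeEq_calls _ _).2 (Dat.ofNat_injective.ne h)) (.pure rfl rfl))
        (.call ih (.pure rfl rfl)))) (by simp only [Dat.size]; omega)

theorem allSide_calls (env : Sides) (s : Bool) (xs : List ℕ) :
    Calls reduction 4 (.cons (.ofBool s) (.cons (Sides.enc env) (encVars xs))) (.ofBool (allSide env s xs))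
      ((xs.length + 1) * ((Sides.enc env).size + 1)) := by
  induction xs with
  | nil =>
    exact .intro rfl (by decide) (.ite_false (.pure rfl rfl) (.pure rfl rfl)) (by simp)
  | cons x xs ih =>
    have h := side_calls env x
    have hN : ∀ {C}, C ≤ (Sides.enc env).size + (xs.length + 1) * ((Sides.enc env).size + 1) →
        C + 1 ≤ ((x :: xs).length + 1) * ((Sides.enc env).size + 1) := fun hC => by
      rw [List.length_cons, add_mul _ 1]; omega
    have hv : allSide env s (x :: xs) = ((env.side x == s) && allSide env s xs) := rfl
    rw [hv]
    rcases hs : env.side x with _ | _ <;> rw [hs] at h <;> cases s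
    · exact .intro rfl (by decide) (.ite_true (.pure rfl rfl) (.ite_false (.call h (.pure rfl rfl))
        (.ite_false (.pure rfl rfl) (.call ih (.pure rfl rfl))))) (hN (by simp))
    · exact .intro rfl (by decide) (.ite_true (.pure rfl rfl) (.ite_false (.call h (.pure rfl rfl))
        (.ite_true (.pure rfl rfl) (.pure rfl rfl)))) (hN (by simp))
    · exact .intro rfl (by decide) (.ite_true (.pure rfl rfl) (.ite_true (.call h (.pure rfl rfl))
        (.ite_false (.pure rfl rfl) (.pure rfl rfl)))) (hN (by simp))
    · exact .intro rfl (by decide) (.ite_true (.pure rfl rfl) (.ite_true (.call h (.pure rfl rfl))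
        (.ite_true (.pure rfl rfl) (.call ih (.pure rfl rfl))))) (hN (by simp))

section

variable {L : FirstOrder.Language.{uF, uR}} (sym : ∀ k, L.Relations k → Dat)

/-- Apart from copying the literal, only its polarity is read from its code; hence one statement
serves relational literals and equalities. -/
theorem lit_calls (env : Sides) (xs : List ℕ) (pos : Bool) (ψ : Fml L) {t d : Dat}
    (hψ : ψ.enc sym = .cons t (.cons (.ofBool pos) d)) :
    Calls reduction 5 (.cons (ψ.enc sym) (.cons (Sides.enc env) (encVars xs)))
      ((litComb pos (allSide env true xs) (allSide env false xs) ψ).enc sym)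
      (2 * ((xs.length + 1) * ((Sides.enc env).size + 1)) + 1) := by
  have h₁ := allSide_calls env true xs
  have h₂ := allSide_calls env false xs
  generalize allSide env true xs = a₁ at h₁ ⊢
  generalize allSide env false xs = a₂ at h₂ ⊢
  cases pos <;> cases a₁ <;> cases a₂ <;>
    simp only [litComb, if_true, Bool.false_eq_true, if_false, Comb.enc, hψ]
  · refine .intro rfl (by decide) (.ite_false (.pure rfl rfl) (.cons (.pure rfl rfl)
      (.cons (.ite_false (.call h₁ (.pure rfl rfl)) (.pure rfl rfl))
        (.ite_false (.call h₂ (.pure rfl rfl)) (.pure rfl rfl))))) ?_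
    omega
  · refine .intro rfl (by decide) (.ite_false (.pure rfl rfl) (.cons (.pure rfl rfl)
      (.cons (.ite_false (.call h₁ (.pure rfl rfl)) (.pure rfl rfl))
        (.ite_true (.call h₂ (.pure rfl rfl)) (.pure rfl rfl))))) ?_
    omega
  · refine .intro rfl (by decide) (.ite_false (.pure rfl rfl) (.cons (.pure rfl rfl)
      (.cons (.ite_true (.call h₁ (.pure rfl rfl)) (.pure rfl rfl))
        (.ite_false (.call h₂ (.pure rfl rfl)) (.pure rfl rfl))))) ?_
    omega
  · refine .intro rfl (by decide) (.ite_false (.pure rfl rfl) (.cons (.pure rfl rfl)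
      (.cons (.ite_true (.call h₁ (.pure rfl rfl)) (.pure rfl rfl))
        (.ite_true (.call h₂ (.pure rfl rfl)) (.pure rfl rfl))))) ?_
    omega
  · refine .intro rfl (by decide) (.ite_true (.pure rfl rfl) (.cons (.pure rfl rfl)
      (.cons (.ite_false (.call h₁ (.pure rfl rfl)) (.pure rfl rfl))
        (.ite_false (.call h₂ (.pure rfl rfl)) (.pure rfl rfl))))) ?_
    omega
  · refine .intro rfl (by decide) (.ite_true (.pure rfl rfl) (.cons (.pure rfl rfl)
      (.cons (.ite_false (.call h₁ (.pure rfl rfl)) (.pure rfl rfl))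
        (.ite_true (.call h₂ (.pure rfl rfl)) (.pure rfl rfl))))) ?_
    omega
  · refine .intro rfl (by decide) (.ite_true (.pure rfl rfl) (.cons (.pure rfl rfl)
      (.cons (.ite_true (.call h₁ (.pure rfl rfl)) (.pure rfl rfl))
        (.ite_false (.call h₂ (.pure rfl rfl)) (.pure rfl rfl))))) ?_
    omega
  · refine .intro rfl (by decide) (.ite_true (.pure rfl rfl) (.cons (.pure rfl rfl)
      (.cons (.ite_true (.call h₁ (.pure rfl rfl)) (.pure rfl rfl))
        (.ite_true (.call h₂ (.pure rfl rfl)) (.pure rfl rfl))))) ?_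
    omega

theorem mapQuant_calls (s : Bool) (K : Kind) (z : ℕ) (l l' : List (Fml L × Fml L)) :
    Calls reduction 8
      (.cons (.cons (.ofBool s) (.cons K.enc (.ofNat z))) (.cons (encPairs sym l) (encPairs sym l')))
      (encPairs sym (l.map (quantPair s K z) ++ l')) (l.length + 1) := by
  induction l with
  | nil => exact .intro rfl (by decide) (.ite_false (.pure rfl rfl) (.pure rfl rfl)) le_rfl
  | cons p l ih =>
    cases s <;> cases K <;>
    exact .intro rfl (by decide) (.ite_true (.pure rfl rfl) (.cons (.pure rfl rfl)
      (.call ih (.pure rfl rfl)))) (by simp)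

theorem append_calls (l l' : List (Fml L × Fml L)) :
    Calls reduction 9 (.cons (encPairs sym l) (encPairs sym l')) (encPairs sym (l ++ l'))
      (l.length + 1) := by
  induction l with
  | nil => exact .intro rfl (by decide) (.ite_false (.pure rfl rfl) (.pure rfl rfl)) le_rfl
  | cons p l ih =>
    exact .intro rfl (by decide) (.ite_true (.pure rfl rfl) (.cons (.pure rfl rfl)
      (.call ih (.pure rfl rfl)))) (by simp)

theorem prodRow_calls (K : Kind) (p : Fml L × Fml L) (l l' : List (Fml L × Fml L)) :
    Calls reduction 10
      (.cons (.cons K.enc (.cons (p.1.enc sym) (p.2.enc sym)))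
        (.cons (encPairs sym l) (encPairs sym l')))
      (encPairs sym (l.map (fun q => (K.conn p.1 q.1, K.conn p.2 q.2)) ++ l')) (l.length + 1) := by
  induction l with
  | nil => exact .intro rfl (by decide) (.ite_false (.pure rfl rfl) (.pure rfl rfl)) le_rfl
  | cons q l ih =>
    cases K <;>
    exact .intro rfl (by decide) (.ite_true (.pure rfl rfl) (.cons (.pure rfl rfl)
      (.call ih (.pure rfl rfl)))) (by simp)

theorem prod_calls (K : Kind) (l l' : List (Fml L × Fml L)) :
    Calls reduction 11 (.cons K.enc (.cons (encPairs sym l) (encPairs sym l')))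
      (encPairs sym (prodPairs K l l')) ((l.length + 1) * (l'.length + 2)) := by
  induction l with
  | nil => exact .intro rfl (by decide) (.ite_false (.pure rfl rfl) (.pure rfl rfl)) (by simp)
  | cons p l ih =>
    exact .intro rfl (by decide) (.ite_true (.pure rfl rfl)
      (.call (prodRow_calls sym K p l' (prodPairs K l l')) (.cons (.pure rfl rfl)
        (.cons (.pure rfl rfl) (.call ih (.pure rfl rfl))))))
      (by
        have : (l.length + 1 + 1) * (l'.length + 2) =
          (l.length + 1) * (l'.length + 2) + (l'.length + 2) := Nat.succ_mul _ _
        rw [List.length_cons]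
        omega)

theorem Comb.three_le_size (b : Comb L) : 3 ≤ b.size sym := by
  induction b with
  | tru => exact le_rfl
  | fls => simp [Comb.size_fls]
  | leaf s ψ => have := (Comb.size_leaf sym s ψ).1; omega
  | and α β => rw [Comb.size_and]; omega
  | or α β => rw [Comb.size_or]; omega

theorem normalForm_calls (K : Kind) (b : Comb L) :
    Calls reduction 12 (.cons K.enc (b.enc sym)) (encPairs sym (normalForm K b))
      (2 ^ (2 * b.size sym)) := by
  have one (b : Comb L) : 0 + 1 ≤ 2 ^ (2 * b.size sym) := Nat.one_le_two_pow
  -- One estimate for both connectives: the cost of a concatenation is also below the product of the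
  -- lengths, which are bounded through the weights. The surplus of 11 nodes supplies the factor 4
  -- that absorbs the recursive calls.
  have joint (α β : Comb L) {W M : ℕ} (hW : α.size sym + β.size sym + 11 ≤ W)
      (hM : M ≤ ((normalForm K α).length + 1) * ((normalForm K β).length + 2)) :
      2 ^ (2 * α.size sym) + 2 ^ (2 * β.size sym) + M + 1 ≤ 2 ^ (2 * W) := by
    have h₁ := (length_le_pairsWeight sym _).trans (pairsWeight_normalForm_le sym K α)
    have h₂ := (length_le_pairsWeight sym _).trans (pairsWeight_normalForm_le sym K β)
    have h₃ : 2 ^ 6 ≤ 2 ^ (2 * α.size sym) :=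
      Nat.pow_le_pow_right two_pos (by have := Comb.three_le_size sym α; omega)
    have h₄ : 2 ^ 6 ≤ 2 ^ (2 * β.size sym) :=
      Nat.pow_le_pow_right two_pos (by have := Comb.three_le_size sym β; omega)
    have h₅ : 2 ^ (2 * α.size sym) * 2 ^ (2 * β.size sym) * 4 ≤ 2 ^ (2 * W) := by
      rw [← pow_add, show 4 = 2 ^ 2 from rfl, ← pow_add]
      exact Nat.pow_le_pow_right two_pos (by omega)
    have h₆ := hM.trans (Nat.mul_le_mul (show _ ≤ 2 ^ (2 * α.size sym) by omega)
      (show _ ≤ 2 ^ (2 * β.size sym) by omega))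
    nlinarith
  have hprod (α β : Comb L) := prod_calls sym K (normalForm K α) (normalForm K β)
  have happ (α β : Comb L) := append_calls sym (normalForm K α) (normalForm K β)
  induction b with
  | tru =>
    cases K <;>
    exact .intro rfl (by decide) (.ite_false (.pure rfl rfl) (.pure rfl rfl)) (one _)
  | fls =>
    cases K <;> exact .intro rfl (by decide) (.ite_true (.pure rfl rfl)
      (.ite_false (.pure rfl rfl) (.pure rfl rfl))) (one _)
  | leaf s ψ =>
    cases s
    · cases K <;> exact .intro rfl (by decide) (.ite_true (.pure rfl rfl)
        (.ite_true (.pure rfl rfl) (.ite_true (.pure rfl rfl) (.ite_false (.pure rfl rfl)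
          (.pure rfl rfl))))) (one _)
    · cases K <;> exact .intro rfl (by decide) (.ite_true (.pure rfl rfl)
        (.ite_true (.pure rfl rfl) (.ite_false (.pure rfl rfl) (.pure rfl rfl)))) (one _)
  | and α β ih ih' =>
    cases K
    · exact .intro rfl (by decide) (.ite_true (.pure rfl rfl) (.ite_true (.pure rfl rfl)
        (.ite_true (.pure rfl rfl) (.ite_true (.pure rfl rfl) (.ite_false (.pure rfl rfl)
          (.ite_true (.pure rfl rfl) (.call (hprod α β) (.cons (.pure rfl rfl)
            (.cons (.call ih (.pure rfl rfl)) (.call ih' (.pure rfl rfl)))))))))))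
        (by have := joint α β (Comb.size_and sym α β).ge le_rfl; omega)
    · exact .intro rfl (by decide) (.ite_true (.pure rfl rfl) (.ite_true (.pure rfl rfl)
        (.ite_true (.pure rfl rfl) (.ite_true (.pure rfl rfl) (.ite_false (.pure rfl rfl)
          (.ite_false (.pure rfl rfl) (.call (happ α β)
            (.cons (.call ih (.pure rfl rfl)) (.call ih' (.pure rfl rfl))))))))))
        (by
          have := joint α β (Comb.size_and sym α β).ge
            (Nat.le_mul_of_pos_right _ (Nat.succ_pos _))
          omega)
  | or α β ih ih' =>
    have hs : α.size sym + β.size sym + 11 ≤ (Comb.or α β).size sym := by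
      rw [Comb.size_or]; omega
    cases K
    · exact .intro rfl (by decide) (.ite_true (.pure rfl rfl) (.ite_true (.pure rfl rfl)
        (.ite_true (.pure rfl rfl) (.ite_true (.pure rfl rfl) (.ite_true (.pure rfl rfl)
          (.ite_true (.pure rfl rfl) (.call (happ α β)
            (.cons (.call ih (.pure rfl rfl)) (.call ih' (.pure rfl rfl))))))))))
        (by
          have := joint α β hs (Nat.le_mul_of_pos_right _ (Nat.succ_pos _))
          omega)
    · exact .intro rfl (by decide) (.ite_true (.pure rfl rfl) (.ite_true (.pure rfl rfl)
        (.ite_true (.pure rfl rfl) (.ite_true (.pure rfl rfl) (.ite_true (.pure rfl rfl)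
          (.ite_false (.pure rfl rfl) (.call (hprod α β) (.cons (.pure rfl rfl)
            (.cons (.call ih (.pure rfl rfl)) (.call ih' (.pure rfl rfl)))))))))))
        (by have := joint α β hs le_rfl; omega)

theorem fold_calls (K : Kind) (l : List (Fml L × Fml L)) :
    Calls reduction 13 (.cons K.enc (encPairs sym l)) ((foldPairs K l).enc sym)
      (l.length + 1) := by
  induction l with
  | nil =>
    cases K <;>
    exact .intro rfl (by decide) (.ite_false (.pure rfl rfl) (.pure rfl rfl)) le_rfl
  | cons p l ih =>
    cases K <;>
    exact .intro rfl (by decide) (.ite_true (.pure rfl rfl) (.cons (.pure rfl rfl)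
      (.cons (.pure rfl rfl) (.call ih (.pure rfl rfl))))) (by simp)

theorem entries_calls (b : Comb L) : ∀ l : List (Dat × Fml L × Fml L),
    Calls reduction 14 (.cons (b.enc sym) (encEntries sym l))
      (encEntries sym (b.entries sym ++ l)) (b.size sym) := by
  induction b with
  | tru =>
    exact fun l => .intro rfl (by decide) (.ite_false (.pure rfl rfl) (.pure rfl rfl))
      (by simp [Comb.size_tru])
  | fls =>
    exact fun l => .intro rfl (by decide) (.ite_true (.pure rfl rfl)
      (.ite_false (.pure rfl rfl) (.pure rfl rfl))) (by simp [Comb.size_fls])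
  | leaf s ψ =>
    intro l
    have hs := Comb.three_le_size sym (.leaf s ψ)
    cases s
    · exact .intro rfl (by decide) (.ite_true (.pure rfl rfl) (.ite_true (.pure rfl rfl)
        (.ite_true (.pure rfl rfl) (.ite_false (.pure rfl rfl) (.pure rfl rfl))))) (by omega)
    · exact .intro rfl (by decide) (.ite_true (.pure rfl rfl) (.ite_true (.pure rfl rfl)
        (.ite_false (.pure rfl rfl) (.pure rfl rfl)))) (by omega)
  | and α β ih ih' =>
    intro l
    rw [Comb.entries, List.append_assoc, Comb.size_and]
    exact .intro rfl (by decide) (.ite_true (.pure rfl rfl) (.ite_true (.pure rfl rfl)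
      (.ite_true (.pure rfl rfl) (.ite_true (.pure rfl rfl) (.ite_false (.pure rfl rfl)
        (.call (ih _) (.cons (.pure rfl rfl) (.call (ih' l) (.pure rfl rfl))))))))) (by omega)
  | or α β ih ih' =>
    intro l
    rw [Comb.entries, List.append_assoc, Comb.size_or]
    exact .intro rfl (by decide) (.ite_true (.pure rfl rfl) (.ite_true (.pure rfl rfl)
      (.ite_true (.pure rfl rfl) (.ite_true (.pure rfl rfl) (.ite_true (.pure rfl rfl)
        (.call (ih _) (.cons (.pure rfl rfl) (.call (ih' l) (.pure rfl rfl))))))))) (by omega)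

theorem finish_calls (b : Comb L) :
    Calls reduction 15 (b.enc sym) (.cons (encEntries sym (b.entries sym)) (b.enc sym))
      (b.size sym + 1) := by
  have h := entries_calls sym b []
  rw [List.append_nil] at h
  exact .intro rfl (by decide) (.cons (.call h (.pure rfl rfl)) (.pure rfl rfl)) (by omega)

end

/-! ### Running time of the reduction. -/

section

variable {τ : FirstOrder.Language.{uF, uR}}

/-- The constructor tag of the quantifier. -/
def Kind.quantTag : Kind → Dat
  | .sigma => .tag 6
  | .pi => .tag 7

theorem head_enc_ne_quantTag {K : Kind} {φ : Fml (withP τ)} (h : ¬ IsQuant K φ)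
    (sym : ∀ k, (withP τ).Relations k → Dat) : (φ.enc sym).head ≠ K.quantTag := by
  cases φ <;> cases K <;> first | exact absurd rfl h | exact fun h => nomatch h

theorem size_head_enc_le {L : FirstOrder.Language.{uF, uR}} (sym : ∀ k, L.Relations k → Dat)
    (φ : Fml L) : (φ.enc sym).head.size ≤ 15 := by
  cases φ <;> simp [Fml.enc, Dat.head, Dat.size_tag]

theorem Sides.size_enc_cons_le (s : Bool) (z : ℕ) (env : Sides) :
    (Sides.enc ((s, z) :: env)).size ≤ env.enc.size + (Dat.ofNat z).size + 5 := by
  have := Dat.size_ofBool_le s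
  change (Dat.cons (.cons (.ofBool s) (.ofNat z)) (Sides.enc env)).size ≤ _
  simp only [Dat.size]
  omega

theorem length_le_size_encVars (xs : List ℕ) : 2 * xs.length + 1 ≤ (encVars xs).size := by
  induction xs with
  | nil => exact le_rfl
  | cons x xs ih =>
    have := (Dat.ofNat x).one_le_size
    rw [encVars_cons]
    simp only [Dat.size, List.length_cons]
    omega

variable (code : (Σ k, τ.Relations k) → ℕ)

theorem enc_rel {L : FirstOrder.Language.{uF, uR}} (sym : ∀ k, L.Relations k → Dat) (pos : Bool)
    {k : ℕ} (R : L.Relations k) (x : Fin k → ℕ) :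
    (Fml.rel pos R x).enc sym =
      .cons (.tag 2) (.cons (.ofBool pos) (.cons (sym k R) (encVars (List.ofFn x)))) := by
  rw [Fml.enc, encVars, List.map_ofFn]
  rfl

/-- The function `comb` reduces `φ` within the given time. -/
def CombTime (φ : Fml (withP τ)) (env : Sides) (s : ℕ) : Prop :=
  ∃ N, Calls reduction 6 (.cons (φ.enc (symDatP code)) env.enc)
    ((comb φ env).enc (symDat code)) N ∧
    4 * N ≤ tower (depth φ) (100 * (φ.size (symDatP code) * s))

/-- The function `pairs` computes the normal form of `φ` within the given time. -/
def PairsTime (K : Kind) (φ : Fml (withP τ)) (env : Sides) (s : ℕ) : Prop :=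
  ∃ N, Calls reduction 7 (.cons K.enc (.cons (φ.enc (symDatP code)) env.enc))
    (encPairs (symDat code) (pairs K φ env)) N ∧
    N ≤ 2 ^ tower (coreDepth K φ) (100 * (φ.size (symDatP code) * s))

theorem pairsTime_of_not_isQuant {K : Kind} {φ : Fml (withP τ)} (hφ : ¬ IsQuant K φ) {env : Sides}
    {s : ℕ} (hs : 1 ≤ s) (h : CombTime code φ env s) : PairsTime code K φ env s := by
  obtain ⟨N, hN, hle⟩ := h
  have hnf := normalForm_calls (symDat code) K (comb φ env)
  have heq := (treeEq_calls (φ.enc (symDatP code)).head K.quantTag).2 (head_enc_ne_quantTag hφ _)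
  rw [← pairs_of_not_isQuant hφ] at hnf
  rw [PairsTime, coreDepth_of_not_isQuant hφ]
  refine ⟨18 + N + 2 ^ (2 * (comb φ env).size (symDat code)), ?_, ?_⟩
  · have := size_head_enc_le (symDatP code) φ
    cases K
    · refine .intro rfl (by decide) (.ite_false (.call heq (.pure rfl rfl))
        (.call hnf (.cons (.pure rfl rfl) (.call hN (.pure rfl rfl))))) ?_
      omega
    · refine .intro rfl (by decide) (.ite_false (.call heq (.pure rfl rfl))
        (.call hnf (.cons (.pure rfl rfl) (.call hN (.pure rfl rfl))))) ?_
      omega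
  · have h₁ := ((size_comb_le code φ).1 env).trans (tower_mono (depth φ)
      (Nat.mul_le_mul_left 100 (Nat.le_mul_of_pos_right (φ.size (symDatP code)) hs)))
    have h₂ := (Nat.mul_le_mul_left 100 (Nat.mul_le_mul (φ.three_le_size (symDatP code)) hs)).trans
      (le_tower (depth φ) (100 * (φ.size (symDatP code) * s)))
    generalize tower (depth φ) (100 * (φ.size (symDatP code) * s)) = X at *
    -- The factor 4 gives 2|b| ≤ X/2 and N ≤ X/4; half of the exponent is left to absorb N and the
    -- constant.
    have h₃ : 2 ^ (2 * (comb φ env).size (symDat code)) ≤ 2 ^ (X / 2) :=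
      Nat.pow_le_pow_right two_pos (by omega)
    have h₄ : X / 2 < 2 ^ (X / 2) := Nat.lt_two_pow_self
    have h₅ : 2 ^ (X / 2 + 1) ≤ 2 ^ X := Nat.pow_le_pow_right two_pos (by omega)
    rw [pow_succ] at h₅
    omega

/-- The budget `s` is the same throughout the recursion: below a quantifier the list of sides grows
by at most |z| + 5 while the formula loses at least |z| + 15. Each literal costs about its size
times `s`, whence the product at the bottom of the tower. -/
theorem combTime (φ : Fml (withP τ)) : ∀ (env : Sides) (s : ℕ),
    φ.size (symDatP code) + env.enc.size + 1 ≤ s →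
    CombTime code φ env s ∧ ∀ K, PairsTime code K φ env s := by
  have plain {φ : Fml (withP τ)} {env : Sides} {s : ℕ}
      (hs : φ.size (symDatP code) + env.enc.size + 1 ≤ s) (hφ : ∀ K, ¬ IsQuant K φ)
      (h : CombTime code φ env s) : CombTime code φ env s ∧ ∀ K, PairsTime code K φ env s :=
    ⟨h, fun K => pairsTime_of_not_isQuant code (hφ K) (by omega) h⟩
  have small {φ : Fml (withP τ)} {s N : ℕ} (h : N ≤ φ.size (symDatP code) * s) :
      4 * N ≤ tower (depth φ) (100 * (φ.size (symDatP code) * s)) :=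
    le_trans (by omega) (le_tower _ _)
  have join {φ ψ χ : Fml (withP τ)} {s N N' : ℕ} (hd : depth χ = max (depth φ) (depth ψ))
      (h : 4 * N ≤ tower (depth φ) (100 * (φ.size (symDatP code) * s)))
      (h' : 4 * N' ≤ tower (depth ψ) (100 * (ψ.size (symDatP code) * s)))
      (hs : φ.size (symDatP code) + ψ.size (symDatP code) + 11 ≤ χ.size (symDatP code))
      (hs' : 1 ≤ s) :
      4 * (N + N' + 1) ≤ tower (depth χ) (100 * (χ.size (symDatP code) * s)) := by
    have h₁ := h.trans (tower_le_tower (hd ▸ le_max_left _ _ : depth φ ≤ depth χ) le_rfl)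
    have h₂ := h'.trans (tower_le_tower (hd ▸ le_max_right _ _ : depth ψ ≤ depth χ) le_rfl)
    have h₃ := tower_add_tower_le (depth χ) (100 * (φ.size (symDatP code) * s))
      (100 * (ψ.size (symDatP code) * s)) 4
    have h₄ : tower (depth χ) _ ≤ tower (depth χ) (100 * (χ.size (symDatP code) * s)) :=
      tower_mono (depth χ) (show 100 * (φ.size (symDatP code) * s) +
        100 * (ψ.size (symDatP code) * s) + 2 + 4 ≤ 100 * (χ.size (symDatP code) * s) by nlinarith)
    omega
  induction φ using Fml.quant_induction with
  | tru =>
    refine fun env s hs => plain hs (fun _ => id) ⟨1, ?_, small ?_⟩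
    · exact .intro rfl (by decide) (.ite_false (.pure rfl rfl) (.pure rfl rfl)) le_rfl
    · exact Nat.mul_pos (Fml.three_le_size _ _ |> lt_of_lt_of_le (by norm_num)) (by omega)
  | fls =>
    refine fun env s hs => plain hs (fun _ => id) ⟨1, ?_, small ?_⟩
    · exact .intro rfl (by decide) (.ite_true (.pure rfl rfl)
        (.ite_false (.pure rfl rfl) (.pure rfl rfl))) le_rfl
    · exact Nat.mul_pos (Fml.three_le_size _ _ |> lt_of_lt_of_le (by norm_num)) (by omega)
  | @rel pos k R x =>
    intro env s hs
    have hlen := length_le_size_encVars (List.ofFn x)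
    have hsize : 2 * (List.ofFn x).length + 11 ≤ (Fml.rel pos R x).size (symDatP code) := by
      have h₁ := (Dat.ofBool pos).one_le_size
      have h₂ := (symDatP code k R).one_le_size
      rw [Fml.size, enc_rel]
      simp only [Dat.size, Dat.size_tag]
      omega
    refine plain hs (fun _ => id) ?_
    rw [CombTime, enc_rel]
    rcases R with R | (R : AnnotRel _)
    · refine ⟨2 * (((List.ofFn x).length + 1) * (env.enc.size + 1)) + 2, ?_, small ?_⟩
      -- The literal has the same code over τ and over τ ∪ {P}, as `symDatP` extends `symDat`.
      · have h := lit_calls (symDat code) env (List.ofFn x) pos (.rel pos R x) (enc_rel _ _ _ _)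
        rw [enc_rel] at h
        exact .intro rfl (by decide) (.ite_true (.pure rfl rfl) (.ite_true (.pure rfl rfl)
          (.ite_false (.pure rfl rfl) (.ite_true (.pure rfl rfl) (.call h (.pure rfl rfl))))))
          (by omega)
      · refine le_trans ?_ (Nat.mul_le_mul hsize (show env.enc.size + 1 ≤ s by omega))
        nlinarith
    · refine ⟨env.enc.size + 1, ?_, small ?_⟩
      · cases R
        have h := side_calls env (x 0)
        simp only [comb, reduce, plainResult, relComb]
        generalize env.side (x 0) = b at h ⊢
        cases b <;> cases pos
        · exact .intro rfl (by decide) (.ite_true (.pure rfl rfl) (.ite_true (.pure rfl rfl)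
            (.ite_false (.pure rfl rfl) (.ite_false (.pure rfl rfl)
              (.ite_false (.call h (.pure rfl rfl)) (.pure rfl rfl)))))) (by omega)
        · exact .intro rfl (by decide) (.ite_true (.pure rfl rfl) (.ite_true (.pure rfl rfl)
            (.ite_false (.pure rfl rfl) (.ite_false (.pure rfl rfl)
              (.ite_false (.call h (.pure rfl rfl)) (.pure rfl rfl)))))) (by omega)
        · exact .intro rfl (by decide) (.ite_true (.pure rfl rfl) (.ite_true (.pure rfl rfl)
            (.ite_false (.pure rfl rfl) (.ite_false (.pure rfl rfl)
              (.ite_true (.call h (.pure rfl rfl)) (.pure rfl rfl)))))) (by omega)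
        · exact .intro rfl (by decide) (.ite_true (.pure rfl rfl) (.ite_true (.pure rfl rfl)
            (.ite_false (.pure rfl rfl) (.ite_false (.pure rfl rfl)
              (.ite_true (.call h (.pure rfl rfl)) (.pure rfl rfl)))))) (by omega)
      · refine le_trans ?_ (Nat.mul_le_mul hsize (show env.enc.size + 1 ≤ s by omega))
        nlinarith
  | eq pos x y =>
    intro env s hs
    have hsize : 12 ≤ (Fml.eq pos x y : Fml (withP τ)).size (symDatP code) := by
      have h₁ := (Dat.ofBool pos).one_le_size
      have h₂ := (Dat.ofNat x).one_le_size
      have h₃ := (Dat.ofNat y).one_le_size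
      rw [Fml.size, Fml.enc]
      simp only [Dat.size, Dat.size_tag]
      omega
    refine plain hs (fun _ => id) ⟨6 * (env.enc.size + 1) + 2, ?_, small ?_⟩
    · have h := lit_calls (symDat code) env [x, y] pos (.eq pos x y) rfl
      exact .intro rfl (by decide) (.ite_true (.pure rfl rfl) (.ite_true (.pure rfl rfl)
        (.ite_true (.pure rfl rfl) (.ite_false (.pure rfl rfl) (.call h (.pure rfl rfl))))))
        (by simp only [List.length_cons, List.length_nil]; omega)
    · refine le_trans ?_ (Nat.mul_le_mul hsize (show env.enc.size + 1 ≤ s by omega))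
      omega
  | and φ ψ ih ih' =>
    intro env s hs
    have hsize : φ.size (symDatP code) + ψ.size (symDatP code) + 11 ≤
        (Fml.and φ ψ).size (symDatP code) := by
      simp [Fml.size, Fml.enc, Dat.size, Dat.size_tag]; omega
    obtain ⟨N, h, hN⟩ := (ih env s (by omega)).1
    obtain ⟨N', h', hN'⟩ := (ih' env s (by omega)).1
    refine plain hs (fun _ => id) ⟨N + N' + 1, ?_, join rfl hN hN' hsize (by omega)⟩
    exact .intro rfl (by decide) (.ite_true (.pure rfl rfl) (.ite_true (.pure rfl rfl)
      (.ite_true (.pure rfl rfl) (.ite_true (.pure rfl rfl) (.ite_false (.pure rfl rfl)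
        (.cons (.pure rfl rfl) (.cons (.call h (.pure rfl rfl)) (.call h' (.pure rfl rfl)))))))))
      (by omega)
  | or φ ψ ih ih' =>
    intro env s hs
    have hsize : φ.size (symDatP code) + ψ.size (symDatP code) + 11 ≤
        (Fml.or φ ψ).size (symDatP code) := by
      simp [Fml.size, Fml.enc, Dat.size, Dat.size_tag]; omega
    obtain ⟨N, h, hN⟩ := (ih env s (by omega)).1
    obtain ⟨N', h', hN'⟩ := (ih' env s (by omega)).1
    refine plain hs (fun _ => id) ⟨N + N' + 1, ?_, join rfl hN hN' hsize (by omega)⟩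
    exact .intro rfl (by decide) (.ite_true (.pure rfl rfl) (.ite_true (.pure rfl rfl)
      (.ite_true (.pure rfl rfl) (.ite_true (.pure rfl rfl) (.ite_true (.pure rfl rfl)
        (.ite_false (.pure rfl rfl)
          (.cons (.pure rfl rfl)
            (.cons (.call h (.pure rfl rfl)) (.call h' (.pure rfl rfl))))))))))
      (by omega)
  | quant K z φ ih =>
    intro env s hs
    have hz := K.le_size_quant (symDatP code) z φ
    have hs' (b : Bool) :
        φ.size (symDatP code) + (Sides.enc ((b, z) :: env)).size + 1 ≤ s := by
      have := Sides.size_enc_cons_le b z env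
      omega
    obtain ⟨N₁, h₁, hN₁⟩ := (ih ((true, z) :: env) s (hs' true)).2 K
    obtain ⟨N₂, h₂, hN₂⟩ := (ih ((false, z) :: env) s (hs' false)).2 K
    have hX : tower (coreDepth K φ) (100 * φ.size (symDatP code)) ≤
        tower (coreDepth K φ) (100 * (φ.size (symDatP code) * s)) :=
      tower_mono _ (Nat.mul_le_mul_left _ (Nat.le_mul_of_pos_right _ (by omega)))
    have hlen (env : Sides) : 50 * (pairs K φ env).length ≤
        2 ^ tower (coreDepth K φ) (100 * (φ.size (symDatP code) * s)) :=
      (length_le_pairsWeight _ _).trans (((size_comb_le code φ).2 K env).trans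
        (Nat.pow_le_pow_right two_pos hX))
    -- The quantifier adds at least 100(|z| + 15) · s at the bottom of the tower, which covers |z| +
    -- k.
    have hroom (k : ℕ) (hk : k ≤ 1000) :
        tower (coreDepth K φ) (100 * (φ.size (symDatP code) * s)) + (Dat.ofNat z).size + k ≤
        tower (coreDepth K φ) (100 * ((K.quant z φ).size (symDatP code) * s)) := by
      have := tower_add_le (coreDepth K φ) (100 * (φ.size (symDatP code) * s))
        ((Dat.ofNat z).size + k)
      refine le_trans (by omega) (this.trans (tower_mono _ ?_))
      nlinarith
    have hN : ∃ N, Calls reduction 7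
        (.cons K.enc (.cons ((K.quant z φ).enc (symDatP code)) env.enc))
        (encPairs (symDat code) (pairs K (K.quant z φ) env)) N ∧
        N ≤ 2 ^ (tower (coreDepth K φ) (100 * (φ.size (symDatP code) * s)) + 5) := by
      -- Here 18 is 15 for comparing the tags, one final call for each of the two lists, and the
      -- call itself.
      refine ⟨N₁ + N₂ + (pairs K φ ((true, z) :: env)).length +
        (pairs K φ ((false, z) :: env)).length + 18, ?_, ?_⟩
      · have heq := (treeEq_calls K.quantTag K.quantTag).1 rfl
        have hm₂ := mapQuant_calls (symDat code) false K z (pairs K φ ((false, z) :: env)) []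
        rw [List.append_nil] at hm₂
        have hm₁ := mapQuant_calls (symDat code) true K z (pairs K φ ((true, z) :: env))
          ((pairs K φ ((false, z) :: env)).map (quantPair false K z))
        rw [← pairs_quant] at hm₁
        have htag : K.quantTag.size ≤ 15 := by cases K <;> simp [Kind.quantTag, Dat.size_tag]
        cases K
        · refine .intro rfl (by decide) (.ite_true (.call heq (.pure rfl rfl))
            (.call hm₁ (.cons (.pure rfl rfl) (.cons (.call h₁ (.pure rfl rfl))
              (.call hm₂ (.cons (.pure rfl rfl) (.cons (.call h₂ (.pure rfl rfl))
                (.pure rfl rfl)))))))) ?_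
          omega
        · refine .intro rfl (by decide) (.ite_true (.call heq (.pure rfl rfl))
            (.call hm₁ (.cons (.pure rfl rfl) (.cons (.call h₁ (.pure rfl rfl))
              (.call hm₂ (.cons (.pure rfl rfl) (.cons (.call h₂ (.pure rfl rfl))
                (.pure rfl rfl)))))))) ?_
          omega
      · have h₃ := hlen ((true, z) :: env)
        have h₄ := hlen ((false, z) :: env)
        have h₅ : 1 ≤ 2 ^ tower (coreDepth K φ) (100 * (φ.size (symDatP code) * s)) :=
          Nat.one_le_two_pow
        rw [pow_add]
        omega
    obtain ⟨N, hpairs, hN⟩ := hN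
    have hcomb : CombTime code (K.quant z φ) env s := by
      refine ⟨N + (pairs K (K.quant z φ) env).length + 2, ?_, ?_⟩
      · have hf := fold_calls (symDat code) K (pairs K (K.quant z φ) env)
        rw [← comb_quant] at hf
        cases K
        · exact .intro rfl (by decide) (.ite_true (.pure rfl rfl) (.ite_true (.pure rfl rfl)
            (.ite_true (.pure rfl rfl) (.ite_true (.pure rfl rfl) (.ite_true (.pure rfl rfl)
              (.ite_true (.pure rfl rfl) (.ite_false (.pure rfl rfl) (.call hf
                (.cons (.pure rfl rfl) (.call hpairs (.pure rfl rfl))))))))))) (by omega)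
        · exact .intro rfl (by decide) (.ite_true (.pure rfl rfl) (.ite_true (.pure rfl rfl)
            (.ite_true (.pure rfl rfl) (.ite_true (.pure rfl rfl) (.ite_true (.pure rfl rfl)
              (.ite_true (.pure rfl rfl) (.ite_true (.pure rfl rfl) (.call hf
                (.cons (.pure rfl rfl) (.call hpairs (.pure rfl rfl))))))))))) (by omega)
      · have h₃ := (length_le_pairsWeight (symDat code) _).trans
          (pairsWeight_pairs_quant_le code ((size_comb_le code φ).2 K) (z := z) env)
        rw [depth_quant]
        refine le_trans ?_ (Nat.pow_le_pow_right two_pos (hroom 10 (by norm_num)))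
        have h₄ : 2 ^ (tower (coreDepth K φ) (100 * (φ.size (symDatP code) * s)) + 5) ≤
            2 ^ (tower (coreDepth K φ) (100 * (φ.size (symDatP code) * s)) +
              (Dat.ofNat z).size + 5) := Nat.pow_le_pow_right two_pos (by omega)
        have h₅ : 2 ^ (tower (coreDepth K φ) (100 * φ.size (symDatP code)) +
            (Dat.ofNat z).size + 1) ≤
            2 ^ (tower (coreDepth K φ) (100 * (φ.size (symDatP code) * s)) +
              (Dat.ofNat z).size + 5) := Nat.pow_le_pow_right two_pos (by omega)
        have h₆ : 2 ^ (tower (coreDepth K φ) (100 * (φ.size (symDatP code) * s)) +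
            (Dat.ofNat z).size + 10) =
            2 ^ (tower (coreDepth K φ) (100 * (φ.size (symDatP code) * s)) +
              (Dat.ofNat z).size + 5) * 2 ^ 5 := (pow_add 2 _ 5)
        have h₇ : 1 ≤ 2 ^ (tower (coreDepth K φ) (100 * (φ.size (symDatP code) * s)) +
          (Dat.ofNat z).size + 5) := Nat.one_le_two_pow
        omega
    refine ⟨hcomb, fun K' => ?_⟩
    by_cases h : K' = K
    · subst h
      rw [PairsTime, coreDepth_quant]
      exact ⟨N, hpairs, hN.trans (Nat.pow_le_pow_right two_pos
        (le_trans (by omega) (hroom 5 (by norm_num))))⟩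
    · exact pairsTime_of_not_isQuant code
        (by cases K <;> cases K' <;> simp_all [IsQuant, Kind.quant]) (by omega) hcomb

end

/-! ### From combinations to reduction sequences. -/

section

variable {L : FirstOrder.Language.{uF, uR}}

/-- Needed because an entry is indexed by the code of its formula. -/
theorem Fml.enc_injective {sym : ∀ k, L.Relations k → Dat}
    (hsym : ∀ k k' R R', sym k R = sym k' R' → (⟨k, R⟩ : Σ k, L.Relations k) = ⟨k', R'⟩) :
    Function.Injective (Fml.enc sym) := by
  intro φ
  induction φ with
  | tru => intro ψ h; cases ψ <;> first | rfl | exact nomatch h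
  | fls => intro ψ h; cases ψ <;> first | rfl | exact nomatch h
  | rel pos R x =>
    intro ψ h
    cases ψ with
    | rel pos' R' x' =>
      simp only [Fml.enc, Dat.cons.injEq, true_and] at h
      obtain ⟨hp, hR, hx⟩ := h
      obtain rfl := Dat.ofBool_injective hp
      cases hsym _ _ _ _ hR
      have hx := List.ofFn_injective (Dat.ofList_injective hx)
      obtain rfl : x = x' := funext fun i => Dat.ofNat_injective (congrFun hx i)
      rfl
    | _ => exact nomatch h
  | eq pos x y =>
    intro ψ h
    cases ψ with
    | eq pos' x' y' =>
      simp only [Fml.enc, Dat.cons.injEq, true_and] at h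
      rw [Dat.ofBool_injective h.1, Dat.ofNat_injective h.2.1, Dat.ofNat_injective h.2.2]
    | _ => exact nomatch h
  | and φ φ' ih ih' =>
    intro ψ h
    cases ψ with
    | and ψ ψ' =>
      simp only [Fml.enc, Dat.cons.injEq, true_and] at h
      rw [ih h.1, ih' h.2]
    | _ => exact nomatch h
  | or φ φ' ih ih' =>
    intro ψ h
    cases ψ with
    | or ψ ψ' =>
      simp only [Fml.enc, Dat.cons.injEq, true_and] at h
      rw [ih h.1, ih' h.2]
    | _ => exact nomatch h
  | ex z φ ih =>
    intro ψ h
    cases ψ with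
    | ex z' ψ =>
      simp only [Fml.enc, Dat.cons.injEq, true_and] at h
      rw [Dat.ofNat_injective h.1, ih h.2]
    | _ => exact nomatch h
  | all z φ ih =>
    intro ψ h
    cases ψ with
    | all z' ψ =>
      simp only [Fml.enc, Dat.cons.injEq, true_and] at h
      rw [Dat.ofNat_injective h.1, ih h.2]
    | _ => exact nomatch h

theorem enc_symDat_injective {code : (Σ k, L.Relations k) → ℕ} (hcode : Function.Injective code) :
    Function.Injective (Fml.enc (symDat code)) :=
  Fml.enc_injective fun _ _ _ _ h => hcode (Dat.ofNat_injective (Dat.cons.inj h).2)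

variable (sym : ∀ k, L.Relations k → Dat)

/-- The propositional formula of a combination. -/
def Comb.toPForm : Comb L → PForm
  | .tru => .tru
  | .fls => .fls
  | .leaf true ψ => .var₁ (.cons (.ofBool true) (ψ.enc sym))
  | .leaf false ψ => .var₂ (.cons (.ofBool false) (ψ.enc sym))
  | .and α β => .and (α.toPForm) (β.toPForm)
  | .or α β => .or (α.toPForm) (β.toPForm)

/-- Hence the program outputs the combination itself as β and only has to collect the entries. -/
theorem Comb.enc_toPForm (b : Comb L) : (b.toPForm sym).enc = b.enc sym := by
  induction b with
  | tru => rfl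
  | fls => rfl
  | leaf s ψ => cases s <;> rfl
  | and α β ih ih' => simp only [Comb.toPForm, PForm.enc, Comb.enc, ih, ih']
  | or α β ih ih' => simp only [Comb.toPForm, PForm.enc, Comb.enc, ih, ih']

/-- The reduction sequence of a combination. -/
def Comb.toRedSeq (b : Comb L) : RedSeq L := ⟨b.entries sym, b.toPForm sym⟩

theorem Comb.exists_of_mem_entries {C : Bool → Fml L → Prop} {b : Comb L} (hb : b.All C)
    {e : Dat × Fml L × Fml L} (he : e ∈ b.entries sym) : ∃ ψ,
      C true ψ ∧ e = (.cons (.ofBool true) (ψ.enc sym), ψ, .tru) ∨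
      C false ψ ∧ e = (.cons (.ofBool false) (ψ.enc sym), .tru, ψ) := by
  induction b with
  | tru => exact absurd he List.not_mem_nil
  | fls => exact absurd he List.not_mem_nil
  | leaf s ψ =>
    cases s <;> simp only [Comb.entries, List.mem_singleton] at he
    · exact ⟨ψ, .inr ⟨hb, he⟩⟩
    · exact ⟨ψ, .inl ⟨hb, he⟩⟩
  | and α β ih ih' =>
    rcases List.mem_append.1 he with he | he
    exacts [ih hb.1 he, ih' hb.2 he]
  | or α β ih ih' =>
    rcases List.mem_append.1 he with he | he
    exacts [ih hb.1 he, ih' hb.2 he]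

theorem Comb.indices_toPForm (b : Comb L) :
    ∀ i ∈ (b.toPForm sym).indices, ∃ e ∈ b.entries sym, e.1 = i := by
  induction b with
  | tru => exact fun i hi => hi.elim
  | fls => exact fun i hi => hi.elim
  | leaf s ψ =>
    cases s <;>
    · rintro i rfl
      exact ⟨_, List.mem_singleton.2 rfl, rfl⟩
  | and α β ih ih' =>
    rintro i (hi | hi)
    · obtain ⟨e, he, rfl⟩ := ih i hi
      exact ⟨e, List.mem_append_left _ he, rfl⟩
    · obtain ⟨e, he, rfl⟩ := ih' i hi
      exact ⟨e, List.mem_append_right _ he, rfl⟩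
  | or α β ih ih' =>
    rintro i (hi | hi)
    · obtain ⟨e, he, rfl⟩ := ih i hi
      exact ⟨e, List.mem_append_left _ he, rfl⟩
    · obtain ⟨e, he, rfl⟩ := ih' i hi
      exact ⟨e, List.mem_append_right _ he, rfl⟩

/-- Repeated leaves give identical entries. The side must be part of the index, since (ψ, `True`)
and (`True`, ψ) are different entries. -/
theorem Comb.family_entries (hsym : Function.Injective (Fml.enc sym)) (b : Comb L) :
    ∀ e ∈ b.entries sym, ∀ e' ∈ b.entries sym, e.1 = e'.1 → e = e' := by
  intro e he e' he' h
  have all (b : Comb L) : b.All fun _ _ => True := by induction b <;> simp_all [Comb.All]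
  have hb := all b
  obtain ⟨ψ, ⟨-, rfl⟩ | ⟨-, rfl⟩⟩ := Comb.exists_of_mem_entries sym hb he <;>
    obtain ⟨ψ', ⟨-, rfl⟩ | ⟨-, rfl⟩⟩ := Comb.exists_of_mem_entries sym hb he' <;>
    simp only [Dat.cons.injEq, true_and] at h
  · rw [hsym h]
  · exact nomatch h.1
  · exact nomatch h.1
  · rw [hsym h]

theorem Comb.holds_toPForm {A₁ : Type u} {A₂ : Type v} [L.Structure A₁] [L.Structure A₂]
    {v₁ : ℕ → Option A₁} {v₂ : ℕ → Option A₂} {ζ₁ ζ₂ : Dat → Bool} {b : Comb L}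
    (h : ∀ e ∈ b.entries sym, (ζ₁ e.1 = true ↔ e.2.1.Sat v₁) ∧ (ζ₂ e.1 = true ↔ e.2.2.Sat v₂)) :
    (b.toPForm sym).Holds ζ₁ ζ₂ ↔ b.Sat v₁ v₂ := by
  induction b with
  | tru => exact Iff.rfl
  | fls => exact Iff.rfl
  | leaf s ψ =>
    cases s
    · exact (h _ (List.mem_singleton.2 rfl)).2
    · exact (h _ (List.mem_singleton.2 rfl)).1
  | and α β ih ih' =>
    exact and_congr (ih fun e he => h e (List.mem_append_left _ he))
      (ih' fun e he => h e (List.mem_append_right _ he))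
  | or α β ih ih' =>
    exact or_congr (ih fun e he => h e (List.mem_append_left _ he))
      (ih' fun e he => h e (List.mem_append_right _ he))

open Classical in
theorem Comb.models_toRedSeq (hsym : Function.Injective (Fml.enc sym)) (b : Comb L)
    (xs₁ xs₂ : List ℕ) {A₁ : Type u} {A₂ : Type v} [L.Structure A₁] [L.Structure A₂]
    (a₁ : {x // x ∈ xs₁} → A₁) (a₂ : {x // x ∈ xs₂} → A₂) :
    (b.toRedSeq sym).Models xs₁ xs₂ a₁ a₂ ↔
      b.Sat (RedSeq.assign xs₁ a₁) (RedSeq.assign xs₂ a₂) := by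
  constructor
  · rintro ⟨ζ₁, ζ₂, hβ, h⟩
    exact (Comb.holds_toPForm sym h).1 hβ
  · intro hb
    -- An index is declared true if some entry carrying it is satisfied; as the index determines the
    -- entry, this agrees with every entry.
    have h : ∀ e ∈ b.entries sym,
        (decide (∃ e' ∈ b.entries sym, e'.1 = e.1 ∧ e'.2.1.Sat (RedSeq.assign xs₁ a₁)) = true ↔
          e.2.1.Sat (RedSeq.assign xs₁ a₁)) ∧
        (decide (∃ e' ∈ b.entries sym, e'.1 = e.1 ∧ e'.2.2.Sat (RedSeq.assign xs₂ a₂)) = true ↔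
          e.2.2.Sat (RedSeq.assign xs₂ a₂)) := by
      intro e he
      simp only [decide_eq_true_eq]
      refine ⟨⟨?_, fun h => ⟨e, he, rfl, h⟩⟩, ⟨?_, fun h => ⟨e, he, rfl, h⟩⟩⟩ <;>
      · rintro ⟨e', he', hi, h⟩
        rwa [← Comb.family_entries sym hsym b e' he' e he hi]
    exact ⟨_, _, (Comb.holds_toPForm sym (ζ₁ := fun i => decide (∃ e' ∈ b.entries sym,
      e'.1 = i ∧ e'.2.1.Sat (RedSeq.assign xs₁ a₁))) (ζ₂ := fun i => decide (∃ e' ∈ b.entries sym,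
      e'.1 = i ∧ e'.2.2.Sat (RedSeq.assign xs₂ a₂))) h).2 hb, h⟩

theorem Dat.size_ofList_append (l l' : List Dat) :
    (Dat.ofList (l ++ l')).size + 1 = (Dat.ofList l).size + (Dat.ofList l').size := by
  induction l with
  | nil => simp [Dat.ofList, Dat.size]; omega
  | cons d l ih => simp only [List.cons_append, Dat.ofList, Dat.size]; omega

/-- Every leaf formula is written twice in its entry, once in the index and once as a component. -/
theorem Comb.size_encEntries_le (b : Comb L) : (encEntries sym (b.entries sym)).size ≤ 2 * b.size sym := by
  induction b with
  | tru => simp [Comb.size_tru, Comb.entries, encEntries, Dat.ofList, Dat.size]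
  | fls => simp [Comb.size_fls, Comb.entries, encEntries, Dat.ofList, Dat.size]
  | leaf s ψ =>
    have h := (Comb.size_leaf sym s ψ).1
    unfold Fml.size at h
    cases s <;>
      simp only [Comb.entries, encEntries, List.map_cons, List.map_nil, Dat.ofList, Dat.size,
        Fml.enc, Dat.tag, Dat.ofBool] <;> omega
  | and α β ih ih' =>
    have h := Dat.size_ofList_append
      ((α.entries sym).map fun e => .cons e.1 (.cons (e.2.1.enc sym) (e.2.2.enc sym)))
      ((β.entries sym).map fun e => .cons e.1 (.cons (e.2.1.enc sym) (e.2.2.enc sym)))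
    rw [Comb.size_and, Comb.entries, encEntries, List.map_append]
    unfold encEntries at ih ih'
    omega
  | or α β ih ih' =>
    have h := Dat.size_ofList_append
      ((α.entries sym).map fun e => .cons e.1 (.cons (e.2.1.enc sym) (e.2.2.enc sym)))
      ((β.entries sym).map fun e => .cons e.1 (.cons (e.2.1.enc sym) (e.2.2.enc sym)))
    rw [Comb.size_or, Comb.entries, encEntries, List.map_append]
    unfold encEntries at ih ih'
    omega

end

/-! ### The reduction sequence of a formula and its computation. -/

section

variable {τ : FirstOrder.Language.{uF, uR}}

/-- The sides at the start: exactly the given variables belong to the first structure. -/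
def initSides (xs₁ : List ℕ) : Sides := xs₁.map fun x => (true, x)

theorem side_initSides (xs₁ : List ℕ) (x : ℕ) :
    (initSides xs₁).side x = true ↔ x ∈ xs₁ := by
  induction xs₁ with
  | nil => simp [initSides, Sides.side]
  | cons y xs ih =>
    change (if y = x then true else Sides.side (initSides xs) x) = true ↔ _
    by_cases h : y = x
    · simp [h]
    · simp [h, ih, Ne.symm h]

theorem size_enc_initSides_le (xs₁ : List ℕ) :
    (initSides xs₁).enc.size + 4 ≤ 5 * (encVars xs₁).size := by
  induction xs₁ with
  | nil => simp [initSides, Sides.enc, encVars, Dat.ofList, Dat.size]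
  | cons x xs ih =>
    have h₁ := Sides.size_enc_cons_le true x (initSides xs)
    have h₂ := (Dat.ofNat x).one_le_size
    rw [encVars_cons]
    change (Sides.enc ((true, x) :: initSides xs)).size + 4 ≤ _
    simp only [Dat.size]
    omega

theorem merge_initSides (xs₁ xs₂ : List ℕ) {A₁ : Type u} {A₂ : Type v}
    (a₁ : {x // x ∈ xs₁} → A₁) (a₂ : {x // x ∈ xs₂} → A₂) :
    RedSeq.assignSum xs₁ xs₂ a₁ a₂ =
      merge (initSides xs₁) (RedSeq.assign xs₁ a₁) (RedSeq.assign xs₂ a₂) := by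
  funext x
  have h := side_initSides xs₁ x
  by_cases h₁ : x ∈ xs₁
  · simp [RedSeq.assignSum, merge, RedSeq.assign, h, h₁]
  · by_cases h₂ : x ∈ xs₂ <;> simp [RedSeq.assignSum, merge, RedSeq.assign, h, h₁, h₂]

variable (code : (Σ k, τ.Relations k) → ℕ)

/-- The reduction sequence that the program computes. -/
def reductionSequence (φ : Fml (withP τ)) (xs₁ : List ℕ) : RedSeq τ :=
  (comb φ (initSides xs₁)).toRedSeq (symDat code)

theorem isReductionSequence (hcode : Function.Injective code) {K : Kind} {n m : ℕ}
    {φ : Fml (withP τ)} {xs₁ xs₂ : List ℕ} (hφ : InLogic K n m φ)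
    (hfree : ∀ x ∈ φ.freeVars, x ∈ xs₁ ∨ x ∈ xs₂) :
    (reductionSequence code φ xs₁).IsReductionSequence (InLogic K n m) xs₁ xs₂ := by
  obtain ⟨⟨r, hr⟩, hm⟩ := hφ
  have htru : InLogic K n m (.tru : Fml τ) := ⟨⟨0, inClass_tru K n⟩, Nat.zero_le m⟩
  have hlogic := ((comb_all_inClass hr).1 (initSides xs₁)).imp
    (C' := fun _ ψ => ∃ r, InClass K n r ψ) (fun _ _ h => ⟨r, h⟩)
  have hlogic (e) (he : e ∈ (reductionSequence code φ xs₁).entries) :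
      InLogic K n m e.2.1 ∧ InLogic K n m e.2.2 := by
    obtain ⟨ψ, h⟩ := Comb.exists_of_mem_entries _ hlogic he
    -- Class and rank are obtained from two descriptions of the same entry; comparing them shows
    -- that side and formula coincide.
    obtain ⟨ψ', h'⟩ := Comb.exists_of_mem_entries _ (comb_all_rank φ _).1 he
    rcases h with ⟨h, rfl⟩ | ⟨h, rfl⟩ <;> rcases h' with ⟨h', he'⟩ | ⟨h', he'⟩ <;>
      simp only [Prod.mk.injEq, Dat.cons.injEq] at he'
    · obtain ⟨-, rfl, -⟩ := he'
      exact ⟨⟨h, h'.trans hm⟩, htru⟩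
    · exact nomatch he'.1.1
    · exact nomatch he'.1.1
    · obtain ⟨-, -, rfl⟩ := he'
      exact ⟨htru, ⟨h, h'.trans hm⟩⟩
  have hvars (e) (he : e ∈ (reductionSequence code φ xs₁).entries) :
      (∀ x ∈ e.2.1.freeVars, x ∈ xs₁) ∧ (∀ x ∈ e.2.2.freeVars, x ∈ xs₂) := by
    obtain ⟨ψ, ⟨h, rfl⟩ | ⟨h, rfl⟩⟩ :=
      Comb.exists_of_mem_entries _ (comb_all_freeVars φ (initSides xs₁)).1 he
    · exact ⟨fun x hx => (side_initSides _ _).1 (h x hx).2, fun x hx => hx.elim⟩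
    · refine ⟨fun x hx => hx.elim, fun x hx => (hfree x (h x hx).1).resolve_left fun hx₁ => ?_⟩
      rw [← side_initSides, (h x hx).2] at hx₁
      exact nomatch hx₁
  exact {
    family := Comb.family_entries _ (enc_symDat_injective hcode) _
    logic₁ := fun e he => (hlogic e he).1
    logic₂ := fun e he => (hlogic e he).2
    free₁ := fun e he => (hvars e he).1
    free₂ := fun e he => (hvars e he).2
    vars := Comb.indices_toPForm _ _ }

theorem isFVDecomposition [τ.IsRelational] (hcode : Function.Injective code)
    {φ : Fml (withP τ)} {xs₁ xs₂ : List ℕ} (hfree : ∀ x ∈ φ.freeVars, x ∈ xs₁ ∨ x ∈ xs₂) :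
    RedSeq.IsFVDecomposition.{uF, uR, u, v} (reductionSequence code φ xs₁) φ xs₁ xs₂ := by
  intro A₁ A₂ _ _ a₁ a₂
  rw [reductionSequence, Comb.models_toRedSeq _ (enc_symDat_injective hcode), merge_initSides]
  refine (comb_sat φ _ _ _ fun x hx => ?_).1
  rw [← merge_initSides]
  by_cases h₁ : x ∈ xs₁
  · simp [RedSeq.assignSum, h₁]
  · simp [RedSeq.assignSum, h₁, (hfree x hx).resolve_left h₁]

theorem encRedSeq_reductionSequence (φ : Fml (withP τ)) (xs₁ : List ℕ) :
    encRedSeq code (reductionSequence code φ xs₁) =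
      .cons (encEntries (symDat code) ((comb φ (initSides xs₁)).entries (symDat code)))
        ((comb φ (initSides xs₁)).enc (symDat code)) := by
  rw [← Comb.enc_toPForm]; rfl

theorem size_encRedSeq_le (φ : Fml (withP τ)) (xs₁ : List ℕ) :
    (encRedSeq code (reductionSequence code φ xs₁)).size ≤
      tower (depth φ) (100 * φ.size (symDatP code)) := by
  have h₁ := Comb.size_encEntries_le (symDat code) (comb φ (initSides xs₁))
  have h₂ := (size_comb_le code φ).1 (initSides xs₁)
  have h₃ := Comb.three_le_size (symDat code) (comb φ (initSides xs₁))
  rw [encRedSeq_reductionSequence, Dat.size]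
  unfold Comb.size at h₁ h₂ h₃
  omega

theorem computes_reductionSequence (φ : Fml (withP τ)) (xs₁ xs₂ : List ℕ) :
    ∃ t, reduction.Computes (encInput code φ xs₁ xs₂)
        (encRedSeq code (reductionSequence code φ xs₁)) t ∧
      t ≤ tower (depth φ) (bodyBound * (1000 * (encInput code φ xs₁ xs₂).size ^ 2)) := by
  have hin : (encInput code φ xs₁ xs₂).size =
      φ.size (symDatP code) + ((encVars xs₁).size + (encVars xs₂).size + 1) + 1 := rfl
  have hφ := φ.three_le_size (symDatP code)
  have hlen := length_le_size_encVars xs₁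
  have henv := size_enc_initSides_le xs₁
  set s := (encInput code φ xs₁ xs₂).size with hs
  -- The initial list of sides is at most five times as large as the code of the first tuple, so `5
  -- * s` suffices as a budget.
  obtain ⟨N, hcomb, hN⟩ := (combTime code φ (initSides xs₁) (5 * s) (by omega)).1
  have hfin := finish_calls (symDat code) (comb φ (initSides xs₁))
  have hsize := (size_comb_le code φ).1 (initSides xs₁)
  rw [← encRedSeq_reductionSequence] at hfin
  have hmain : Calls reduction 0 (encInput code φ xs₁ xs₂)
      (encRedSeq code (reductionSequence code φ xs₁))
      (N + (comb φ (initSides xs₁)).size (symDat code) + xs₁.length + 3) := by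
    refine .intro rfl (by decide) (.call hfin (.call hcomb (.cons (.pure rfl rfl)
      (.call (init_calls xs₁) (.pure rfl rfl))))) ?_
    omega
  obtain ⟨body, t, hbody, heval, ht⟩ := hmain
  refine ⟨t, ⟨body, hbody, heval⟩, ht.trans ((Nat.mul_le_mul_left _ ?_).trans
    (mul_tower_le (depth φ) bodyBound (a := 1000 * s ^ 2) (by nlinarith)))⟩
  have h₁ : tower (depth φ) (100 * (φ.size (symDatP code) * (5 * s))) ≤
      tower (depth φ) (500 * s ^ 2) := tower_mono _ (by nlinarith)
  have h₂ : tower (depth φ) (100 * φ.size (symDatP code)) ≤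
      tower (depth φ) (500 * s ^ 2) := tower_mono _ (by nlinarith)
  have h₃ := tower_add_le (depth φ) (500 * s ^ 2) (xs₁.length + 3)
  have h₄ : tower (depth φ) (500 * s ^ 2 + (xs₁.length + 3)) ≤ tower (depth φ) (1000 * s ^ 2) :=
    tower_mono _ (by nlinarith)
  omega

end

end FVD

open FVD

theorem theorem3 :
    ∃ (c : ℕ) (prog : Program),
      ∀ (τ : FirstOrder.Language.{uF, uR}) [τ.IsRelational] [Finite (Σ k, τ.Relations k)]
        (code : (Σ k, τ.Relations k) → ℕ), Function.Injective code →
      ∀ (K : Kind) (n m : ℕ) (φ : Fml (withP τ)) (xs₁ xs₂ : List ℕ),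
        InLogic K n m φ → List.Disjoint xs₁ xs₂ → (∀ x ∈ φ.freeVars, x ∈ xs₁ ∨ x ∈ xs₂) →
        ∃ D : RedSeq τ,
          D.IsReductionSequence (InLogic K n m) xs₁ xs₂ ∧
          RedSeq.IsFVDecomposition.{uF, uR, u, v} D φ xs₁ xs₂ ∧
          (encRedSeq code D).size ≤ tower n (c * ((n + 1) * (encFml code φ).size)) ∧
          ∃ t, prog.Computes (encInput code φ xs₁ xs₂) (encRedSeq code D) t ∧
            t ≤ tower n (c * ((n + 1) * (encInput code φ xs₁ xs₂).size ^ 2)) := by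
  -- The first factor bounds the number of calls at the bottom of the tower, the second is the cost
  -- per call.
  refine ⟨1000 * bodyBound, Prog.reduction, ?_⟩
  intro τ _ _ code hcode K n m φ xs₁ xs₂ hφ _ hfree
  obtain ⟨⟨r, hr⟩, -⟩ := id hφ
  have hn : depth φ ≤ n := hr.depth_le.1
  refine ⟨reductionSequence code φ xs₁, isReductionSequence code hcode hφ hfree,
    isFVDecomposition code hcode hfree, ?_, ?_⟩
  · refine (size_encRedSeq_le code φ xs₁).trans (tower_le_tower hn ?_)
    -- The bounds hold with the bare size at the bottom of the tower; the factor n + 1 is given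
    -- away, here and for the time.
    exact Nat.mul_le_mul (by decide) (Nat.le_mul_of_pos_left _ n.succ_pos)
  · obtain ⟨t, ht, hle⟩ := computes_reductionSequence code φ xs₁ xs₂
    refine ⟨t, ht, hle.trans (tower_le_tower hn ?_)⟩
    rw [← mul_assoc, mul_comm bodyBound]
    exact Nat.mul_le_mul_left _ (Nat.le_mul_of_pos_left _ n.succ_pos)
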